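/- **Theorem.** Every finite restricted prefix-cyclic (RPC) set $R$ of disjunctive existential rules never-terminates. *Rules and terms.* A rule is a constant- and function-free formula $\rho=\forall \vec w,\vec x.[\beta(\vec w,\vec x)\to\bigvee_{i=1}^n\exists\vec y_i.\,\eta_i(\vec x_i,\vec y_i)]$ with $n\ge 1$, pairwise disjoint variable lists $\vec w,\vec x,\vec y_1,\dots,\vec y_n$, $\bigcup_i\vec x_i=\vec x$, and non-empty conjunctions of atoms $\beta,\eta_i$. Its frontier is $\vec x$; $\mathrm{branching}(\rho)=n$. It is generating if some $\vec y_i$ is non-empty, and datalog if $n=1$ and it is not generating. Its skolemization $\mathrm{sk}(\rho)$ replaces each $y\in\vec y_i$ by $f^{\rho}_{i,y}(\vec x)$ for a function symbol unique for $(\rho,i,y)$. A term is cyclic if it has a subterm $f(\vec s)$ such that $f$ occurs in $\vec s$; it is $\rho$-cyclic if it is of the form $f(\vec s)$ with $f$ occurring both in $\mathrm{sk}(\rho)$ and in $\vec s$. A fact is a variable-free atom; a database is a finite function-free set of facts. *Triggers.* A trigger $\lambda=\langle\rho,\sigma\rangle$ consists of a rule and a map $\sigma$ from the variables of $\beta$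 to ground terms. It is loaded for a fact set $F$ if $\beta\sigma\subseteq F$, and obsolete for $F$ if $\eta_i\tau\subseteq F$ for some $i$ and some $\tau$ extending $\sigma$. Let $\mathrm{out}_i(\lambda)$ be the $i$-th head disjunct of $\mathrm{sk}(\rho)$ under $\sigma$. It is an $R$-trigger if $\rho\in R$ and all terms in the range of $\sigma$ only use function symbols of $\mathrm{sk}(R)$. A fact set satisfies $\rho$ if each trigger with $\rho$ is not loaded or is obsolete for it. *Chase.* A chase tree for $\langle R,D\rangle$ is a (possibly infinite) directed tree, each vertex $v$ labelled with a fact set $F(v)$ and each non-root vertex also with a trigger, such that: (1) the root has $F=D$; (2) for each non-leaf $v$ there is an $R$-trigger $\lambda=\langle\rho,\sigma\rangle$, loaded and not obsolete for $F(v)$, such that $F(v)$ satisfies all datalog rules of $R$ if $\rho$ is not datalog, and $v$ has exactly $\mathrm{branching}(\rho)$ children $c_i$, with $F(c_i)=F(v)\cup\mathrm{out}_i(\lambda)$ and trigger label $\lambda$; (3) $F(v)$ satisfies all rules of $R$ for each leaf $v$, and for each $R$-trigger $\lambda$ loaded for some $F(v)$ there is $k\ge 0$ such that $\lambda$ is obsolete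 for $F(u)$ for all $u$ reachable from $v$ by a path of length $k$. The set $R$ *never-terminates* if there is a database $D$ such that $\langle R,D\rangle$ has no finite chase tree. *Unblockability.* Let $\mathrm{BF}(c)=\emptyset$ for constants $c$, let $\mathrm{BF}(f^\rho_{i,y}(\vec s))=\mathrm{out}_i(\langle\rho,\vec x\mapsto\vec s\rangle)\cup\bigcup_{s\in\vec s}\mathrm{BF}(s)$, and let $\mathrm{BF}(\langle\rho,\sigma\rangle)=\bigcup_{x\in\vec x}\mathrm{BF}(\sigma(x))$. The skeleton $\mathrm{Sk}(\lambda)$ of $\lambda=\langle\rho,\sigma\rangle$ consists of all terms occurring in $\mathrm{BF}(\lambda)$ and all constants $\sigma(x)$ with $x$ in the frontier of $\rho$. Fix distinct special constants $\star$, $c_f$ (for each function symbol $f$) and $c_x$ (for each variable $x$). Let $h_\lambda$ map each term of $\mathrm{Sk}(\lambda)$ and each constant $c_f$ to itself, each other functional term $f(\vec t)$ to $c_f$, and every other term to $\star$. A head-choice $hc$ maps every rule $\rho\in R$ to some $hc(\rho)\in\{1,\dots,\mathrm{branching}(\rho)\}$; write $\mathrm{out}_{hc}(\lambda)=\mathrm{out}_{hc(\rho)}(\lambda)$.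 Let $\mathcal O(R,hc,\lambda)$ be the least fact set that contains all facts over predicates occurring in $R$ and constants in $\mathrm{Sk}(\lambda)\cup\{\star\}$, includes $\mathrm{BF}(\lambda)$, and includes $h_\lambda(\mathrm{out}_{hc}(\lambda'))$ for every $R$-trigger $\lambda'$ that is loaded for $\mathcal O(R,hc,\lambda)$ and has $\mathrm{out}_{hc}(\lambda')\ne\mathrm{out}_{hc}(\lambda)$. An $R$-trigger $\lambda$ is *uc-unblockable* if its rule is datalog or it is not obsolete for $\mathcal O(R,hc,\lambda)$. *RPC.* Let $\sigma_{uc}$ map each variable $x$ to $c_x$. For $\rho\in R$ with body $\beta$, let $\mathrm{RPC}(R,hc,\rho)$ be the least fact set that includes $\beta\sigma_{uc}$, $\mathrm{out}_{hc}(\langle\rho,\sigma_{uc}\rangle)$, and $\mathrm{out}_{hc}(\lambda)$ for every $R$-trigger $\lambda=\langle\psi,\tau\rangle$ such that the range of $\tau$ contains no cyclic term, $\lambda$ is loaded for $\mathrm{RPC}(R,hc,\rho)$, $\lambda$ is uc-unblockable for $R$ and $hc$, and $\tau$ is injective if $\psi=\rho$. The rule set $R$ is *RPC* if, for some head-choice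 $hc$ and some generating $\rho\in R$, some $\rho$-cyclic term occurs in $\mathrm{RPC}(R,hc,\rho)$. -/

import Mathlib

universe u v w

namespace RPC

/-- The predicates (with their arities) and the variables of the language. -/
structure Signature where
  Pred : Type u
  Var : Type v
  ar : Pred → ℕ

/-- Atoms `P(t₁, …, tₙ)` with arguments in `T` and `n = ar P`. -/
structure Atom (S : Signature.{u, v}) (T : Type w) where
  pred : S.Pred
  args : Fin (S.ar pred) → T

/-- Replace every argument `t` of an atom by `f t`. -/
def Atom.map {S : Signature.{u, v}} {T : Type w} {T' : Type*} (f : T → T') (a : Atom S T) :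
    Atom S T' :=
  ⟨a.pred, fun k => f (a.args k)⟩

/-- The variables that occur in a conjunction of constant- and function-free atoms. -/
def varsOf {S : Signature.{u, v}} (l : List (Atom S S.Var)) : Set S.Var :=
  {x | ∃ a ∈ l, ∃ k, a.args k = x}

/-- A disjunctive existential rule
`∀ w, x. (β(w, x) → ⋁ᵢ ∃ yᵢ. ηᵢ(xᵢ, yᵢ))`, with `body = β` and `head i = ηᵢ`. The quantified
variables are determined by the conjunctions: `yᵢ` consists of the variables of `ηᵢ` that do not
occur in `β`, and `x` of the variables of `β` that occur in some `ηᵢ`. The last field says that the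
lists `yᵢ` are pairwise disjoint. -/
structure Rule (S : Signature.{u, v}) where
  body : List (Atom S S.Var)
  branching : ℕ
  head : Fin branching → List (Atom S S.Var)
  body_ne : body ≠ []
  branching_pos : 1 ≤ branching
  head_ne : ∀ i, head i ≠ []
  ex_disjoint : ∀ i j, i ≠ j → ∀ z, z ∈ varsOf (head i) → z ∈ varsOf (head j) → z ∈ varsOf body

section RuleNotions

variable {S : Signature.{u, v}}

/-- The variables of the body (the universally quantified variables). -/
def Rule.bodyVars (ρ : Rule S) : Set S.Var := varsOf ρ.body

/-- The frontier: the body variables that occur in some head disjunct. -/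
def Rule.frontier (ρ : Rule S) : Set S.Var :=
  {x | x ∈ ρ.bodyVars ∧ ∃ i, x ∈ varsOf (ρ.head i)}

/-- The existentially quantified variables of the `i`-th head disjunct. -/
def Rule.exVars (ρ : Rule S) (i : Fin ρ.branching) : Set S.Var :=
  {y | y ∈ varsOf (ρ.head i) ∧ y ∉ ρ.bodyVars}

def Rule.IsDeterministic (ρ : Rule S) : Prop := ρ.branching = 1

def Rule.IsGenerating (ρ : Rule S) : Prop := ∃ i, (ρ.exVars i).Nonempty

def Rule.IsDatalog (ρ : Rule S) : Prop := ρ.IsDeterministic ∧ ¬ ρ.IsGenerating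

end RuleNotions

/-- Function symbols: the Skolem symbol of the triple `⟨ρ, i, y⟩` is this triple. -/
structure FnSym (S : Signature.{u, v}) where
  rule : Rule S
  idx : Fin rule.branching
  var : S.Var

/-- Constants. Besides a countably infinite supply of ordinary constants these are the pairwise
distinct special constants `c_x` (one for each variable), `⋆`, and `c_f` (one for each function
symbol). -/
inductive Const (S : Signature.{u, v}) where
  | base (n : ℕ) : Const S
  | uc (x : S.Var) : Const S
  | star : Const S
  | fn (f : FnSym S) : Const S

/-- Ground terms. The argument positions of a Skolem symbol of the rule `ρ` are indexed by the
frontier variables of `ρ`, so its arity is the size of the frontier. -/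
inductive GTerm (S : Signature.{u, v}) where
  | const (c : Const S) : GTerm S
  | app (f : FnSym S) (args : f.rule.frontier → GTerm S) : GTerm S

/-- Facts: variable-free atoms. -/
abbrev Fact (S : Signature.{u, v}) := Atom S (GTerm S)

section Terms

variable {S : Signature.{u, v}}

/-- The set of all subterms of a ground term, including the term itself. -/
def GTerm.subterms : GTerm S → Set (GTerm S)
  | .const c => {.const c}
  | .app f s => {.app f s} ∪ ⋃ x, (s x).subterms

/-- The function symbols that occur in a ground term. -/
def GTerm.fnSyms : GTerm S → Set (FnSym S)
  | .const _ => ∅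
  | .app f s => {f} ∪ ⋃ x, (s x).fnSyms

/-- A term is cyclic if it has a subterm `f(s)` such that `f` occurs in `s`. -/
def GTerm.IsCyclic (t : GTerm S) : Prop :=
  ∃ f s, GTerm.app f s ∈ t.subterms ∧ ∃ x, f ∈ (s x).fnSyms

/-- The function symbols that occur in the skolemization of `ρ`. -/
def Rule.skSyms (ρ : Rule S) : Set (FnSym S) :=
  {f | f.rule = ρ ∧ f.var ∈ f.rule.exVars f.idx}

/-- A `ρ`-cyclic term: a term of the form `f(s)` such that `f` occurs both in the skolemization of
`ρ` and in `s`. -/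
def GTerm.IsCyclicFor (ρ : Rule S) (t : GTerm S) : Prop :=
  ∃ f s, t = GTerm.app f s ∧ f ∈ ρ.skSyms ∧ ∃ x, f ∈ (s x).fnSyms

/-- (Ground) terms over the function symbols that occur in the skolemization of `R`. -/
def GTerm.IsTermOver (R : Set (Rule S)) (t : GTerm S) : Prop :=
  ∀ f ∈ t.fnSyms, ∃ ρ ∈ R, f ∈ ρ.skSyms

/-- The terms that syntactically occur in a fact set. -/
def termsOf (F : Set (Fact S)) : Set (GTerm S) :=
  {t | ∃ A ∈ F, ∃ k, t ∈ (A.args k).subterms}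

/-- Fact sets without function symbols. -/
def FunctionFree (F : Set (Fact S)) : Prop :=
  ∀ A ∈ F, ∀ k, ∃ c, A.args k = GTerm.const c

open Classical in
/-- The value of a head variable `z` in the `i`-th disjunct of the skolemization of `ρ` if the
frontier variables are mapped to `s`. -/
noncomputable def Rule.skTerm (ρ : Rule S) (i : Fin ρ.branching) (s : ρ.frontier → GTerm S)
    (z : S.Var) : GTerm S :=
  if h : z ∈ ρ.frontier then s ⟨z, h⟩ else GTerm.app ⟨ρ, i, z⟩ s

/-- The instance of the `i`-th disjunct of the skolemization of `ρ` under `s`. -/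
def Rule.outAt (ρ : Rule S) (i : Fin ρ.branching) (s : ρ.frontier → GTerm S) : Set (Fact S) :=
  {A | ∃ a ∈ ρ.head i, A = a.map (ρ.skTerm i s)}

/-- The birth facts of a term. -/
def GTerm.birthFacts : GTerm S → Set (Fact S)
  | .const _ => ∅
  | .app f s => f.rule.outAt f.idx s ∪ ⋃ x, (s x).birthFacts

end Terms

/-- Triggers `⟨ρ, σ⟩`. The substitution `σ` is a partial function with domain `ρ.bodyVars`; it is
given by a total function, of which all notions below only use the values on `ρ.bodyVars`. -/
structure Trigger (S : Signature.{u, v}) where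
  rule : Rule S
  subst : S.Var → GTerm S

section Triggers

variable {S : Signature.{u, v}}

/-- `⟨ρ, σ⟩` is loaded for `F` if all facts of `βσ` are in `F`. -/
def Trigger.Loaded (t : Trigger S) (F : Set (Fact S)) : Prop :=
  ∀ a ∈ t.rule.body, a.map t.subst ∈ F

/-- `⟨ρ, σ⟩` is obsolete for `F` if some extension of `σ` maps some head disjunct into `F`. -/
def Trigger.Obsolete (t : Trigger S) (F : Set (Fact S)) : Prop :=
  ∃ τ : S.Var → GTerm S, (∀ x ∈ t.rule.bodyVars, τ x = t.subst x) ∧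
    ∃ i, ∀ a ∈ t.rule.head i, a.map τ ∈ F

/-- The output of a trigger for the `i`-th head disjunct. -/
def Trigger.out (t : Trigger S) (i : Fin t.rule.branching) : Set (Fact S) :=
  t.rule.outAt i (fun x => t.subst x)

/-- Triggers with a rule from `R` and a substitution whose range consists of terms over `R`. -/
def Trigger.IsTriggerOf (R : Set (Rule S)) (t : Trigger S) : Prop :=
  t.rule ∈ R ∧ ∀ x ∈ t.rule.bodyVars, (t.subst x).IsTermOver R

/-- The birth facts of a trigger. -/
def Trigger.birthFacts (t : Trigger S) : Set (Fact S) :=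
  ⋃ x ∈ t.rule.frontier, (t.subst x).birthFacts

/-- The term-skeleton of a trigger. -/
def Trigger.skeleton (t : Trigger S) : Set (GTerm S) :=
  termsOf t.birthFacts ∪ {s | ∃ c, s = GTerm.const c ∧ ∃ x ∈ t.rule.frontier, t.subst x = s}

/-- A fact set satisfies a rule if every trigger with this rule is not loaded or is obsolete. -/
def Satisfies (F : Set (Fact S)) (ρ : Rule S) : Prop :=
  ∀ t : Trigger S, t.rule = ρ → t.Loaded F → t.Obsolete F

end Triggers

/-- `StepsTo E k v u`: there is an `E`-path of length `k` from `v` to `u`. -/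
def StepsTo {V : Type w} (E : V → V → Prop) : ℕ → V → V → Prop
  | 0, v, u => v = u
  | k + 1, v, u => ∃ x, E v x ∧ StepsTo E k x u

/-- Chase trees of the knowledge base `⟨R, D⟩` for the (datalog-first, disjunctive) restricted
chase. The vertices of a tree `E` with root `root` are labelled with fact sets, and the vertices
other than the root with triggers. -/
structure ChaseTree {S : Signature.{u, v}} (R : Set (Rule S)) (D : Set (Fact S)) where
  V : Type
  E : V → V → Prop
  root : V
  fct : V → Set (Fact S)
  trg : {x : V // x ≠ root} → Trigger S
  not_edge_root : ∀ x, ¬ E x root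
  parent_unique : ∀ x y z, E x z → E y z → x = y
  reachable : ∀ x, Relation.ReflTransGen E root x
  fct_root : fct root = D
  step : ∀ x, (∃ y, E x y) → ∃ t : Trigger S, t.IsTriggerOf R ∧ t.Loaded (fct x) ∧
    ¬ t.Obsolete (fct x) ∧
    (¬ t.rule.IsDatalog → ∀ ψ ∈ R, ψ.IsDatalog → Satisfies (fct x) ψ) ∧
    ∃ c : Fin t.rule.branching → {y : V // y ≠ root}, Function.Injective c ∧
      (∀ y, E x y ↔ ∃ i, (c i : V) = y) ∧
      ∀ i, fct (c i) = fct x ∪ t.out i ∧ trg (c i) = t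
  leaf : ∀ x, (¬ ∃ y, E x y) → ∀ ψ ∈ R, Satisfies (fct x) ψ
  fair : ∀ x, ∀ t : Trigger S, t.IsTriggerOf R → t.Loaded (fct x) →
    ∃ k, ∀ y, StepsTo E k x y → t.Obsolete (fct y)

section Cyclicity

variable {S : Signature.{u, v}}

/-- `R` never-terminates: for some (finite) database `D`, the knowledge base `⟨R, D⟩` has no finite
chase tree. -/
def NeverTerminates (R : Set (Rule S)) : Prop :=
  ∃ D : Set (Fact S), D.Finite ∧ FunctionFree D ∧ ∀ T : ChaseTree R D, Infinite T.V

/-- Head-choices. Since every rule has a head disjunct, a head-choice for a rule set is the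
restriction of such a function, and only the values on the rule set are used below. -/
abbrev HeadChoice (S : Signature.{u, v}) := (ρ : Rule S) → Fin ρ.branching

/-- The output of a trigger according to a head-choice. -/
def Trigger.outHc (t : Trigger S) (hc : HeadChoice S) : Set (Fact S) :=
  t.out (hc t.rule)

open Classical in
/-- The mapping `h^uc` of a trigger: terms in the skeleton and constants `c_f` are mapped to
themselves, functional terms `f(s)` outside of the skeleton to `c_f`, and all others to `⋆`. -/
noncomputable def Trigger.hUc (t : Trigger S) (s : GTerm S) : GTerm S :=
  if s ∈ t.skeleton then s
  else match s with
    | .app f _ => .const (.fn f)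
    | .const (.fn f) => .const (.fn f)
    | .const _ => .const .star

/-- The predicate `p` occurs in the rule set `R`. -/
def PredOccurs (R : Set (Rule S)) (p : S.Pred) : Prop :=
  ∃ ρ ∈ R, ∃ a : Atom S S.Var, (a ∈ ρ.body ∨ ∃ i, a ∈ ρ.head i) ∧ a.pred = p

/-- The over-approximation `𝒪(R, hc, t, h^uc)`: the least fact set that
* contains all facts over predicates of `R` and constants from the skeleton of `t` and `⋆`,
* includes the birth facts of `t`, and
* includes `h^uc(out_hc(t'))` for all loaded `R`-triggers `t'` with `out_hc(t') ≠ out_hc(t)`. -/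
inductive OverApprox (R : Set (Rule S)) (hc : HeadChoice S) (t : Trigger S) : Fact S → Prop
  | crit (A : Fact S) (hp : PredOccurs R A.pred)
      (hA : ∀ k, ∃ c, A.args k = GTerm.const c ∧ (A.args k ∈ t.skeleton ∨ c = Const.star)) :
      OverApprox R hc t A
  | birth (A : Fact S) (hA : A ∈ t.birthFacts) : OverApprox R hc t A
  | step (t' : Trigger S) (ht : t'.IsTriggerOf R)
      (hl : ∀ a ∈ t'.rule.body, OverApprox R hc t (a.map t'.subst))
      (hne : t'.outHc hc ≠ t.outHc hc) (A : Fact S) (hA : A ∈ t'.outHc hc) :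
      OverApprox R hc t (A.map t.hUc)

/-- `uc`-unblockable triggers. -/
def Trigger.UcUnblockable (R : Set (Rule S)) (hc : HeadChoice S) (t : Trigger S) : Prop :=
  t.rule.IsDatalog ∨ ¬ t.Obsolete {A | OverApprox R hc t A}

/-- The substitution that maps every variable `x` to the constant `c_x`. -/
def substUc (S : Signature.{u, v}) (x : S.Var) : GTerm S := GTerm.const (Const.uc x)

/-- The rule-database of `ρ`: the facts of its body under `x ↦ c_x`. -/
def Rule.database (ρ : Rule S) : Set (Fact S) :=
  {A | ∃ a ∈ ρ.body, A = a.map (substUc S)}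

/-- The fact set `RPC(R, hc, ρ)`: the least fact set that includes the rule-database of `ρ`, the
output of `⟨ρ, x ↦ c_x⟩`, and the output of every `R`-trigger that has no cyclic term in its range,
is loaded, is `uc`-unblockable, and is injective (on the body variables) if its rule is `ρ`. -/
inductive RpcFacts (R : Set (Rule S)) (hc : HeadChoice S) (ρ : Rule S) : Fact S → Prop
  | database (A : Fact S) (hA : A ∈ ρ.database) : RpcFacts R hc ρ A
  | init (A : Fact S) (hA : A ∈ Trigger.outHc ⟨ρ, substUc S⟩ hc) : RpcFacts R hc ρ A
  | step (t : Trigger S) (ht : t.IsTriggerOf R)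
      (hcyc : ∀ x ∈ t.rule.bodyVars, ¬ (t.subst x).IsCyclic)
      (hl : ∀ a ∈ t.rule.body, RpcFacts R hc ρ (a.map t.subst))
      (hub : t.UcUnblockable R hc)
      (hinj : t.rule = ρ → Set.InjOn t.subst t.rule.bodyVars)
      (A : Fact S) (hA : A ∈ t.outHc hc) : RpcFacts R hc ρ A

/-- Restricted prefix-cyclic rule sets. -/
def IsRPC (R : Set (Rule S)) : Prop :=
  ∃ hc : HeadChoice S, ∃ ρ ∈ R, ρ.IsGenerating ∧
    ∃ t ∈ termsOf {A | RpcFacts R hc ρ A}, t.IsCyclicFor ρ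

end Cyclicity

end RPC

namespace RPC

/-! ### Substitutions of terms for the constants `c_x` -/

section Basics

variable {S : Signature.{u, v}}

/-! Let `hc` and `ρ` witness RPC. The database consists of the body of `ρ` and its disjunct `hc ρ`,
with every variable `x` frozen to `c_x`. In a finite chase tree, the `hc`-children lead from the
root to a leaf with a finite fact set `F` that satisfies `R`. Replacing each frozen existential
constant `c_y` by the Skolem term it stands for turns `F` into a finite set `G` that contains the
starting facts of `RpcFacts`. This loses nothing: a trigger that would create one of these Skolem
terms is obsolete from the outset (`HcDerivation.fresh`), so unfreezing is injective on the terms of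
`F`, and loaded triggers for `G` come from loaded triggers for `F`.

The set `G` is closed under unblockable triggers whose skeleton avoids `⋆` and the `c_f`
(`HcDerivation.outHc_subset`). A loaded trigger `l` is obsolete for `G` because `F` satisfies the
rules. If `l` is datalog, its output is then present. Otherwise, were the output missing, `h^uc`
would map `G` into the over-approximation of `l`, and `l` would be obsolete there, against
unblockability.

Hence the derivation of `RpcFacts` can be replayed inside `G` along a substitution `θ` as soon as
`G` contains its start under `θ` and `θ` is injective and does not already contain the terms to be
born (`RpcFacts.map_subst_mem`). Replaying keeps triggers unblockable, because the
over-approximation of the replayed trigger can be pulled back to that of the original one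
(`ReplaySetup.overApprox_pull`).

A `ρ`-cyclic term yields a trigger `⟨ρ, τ⟩` within the derivation that reproduces its start with new
terms (`RpcFacts.exists_cycle`). All iterates of `τ` are then replayable, so `G` contains the body
of `ρ` under each of them. These involve infinitely many terms (`Cycle.exists_injective`), which
contradicts the finiteness of `G`. -/

theorem Atom.map_congr {T T' : Type*} {f g : T → T'} {a : Atom S T}
    (h : ∀ k, f (a.args k) = g (a.args k)) : a.map f = a.map g :=
  congrArg (Atom.mk a.pred) (funext h)

theorem Atom.map_map {T T' T'' : Type*} (f : T → T') (g : T' → T'') (a : Atom S T) :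
    (a.map f).map g = a.map (fun t => g (f t)) :=
  rfl

theorem mem_varsOf {l : List (Atom S S.Var)} {a : Atom S S.Var} (ha : a ∈ l)
    (k : Fin (S.ar a.pred)) : a.args k ∈ varsOf l :=
  ⟨a, ha, k, rfl⟩

theorem Rule.mem_exVars {ρ : Rule S} {i : Fin ρ.branching} {z : S.Var}
    (hz : z ∈ varsOf (ρ.head i)) (hf : z ∉ ρ.frontier) : z ∈ ρ.exVars i :=
  ⟨hz, fun hb => hf ⟨hb, i, hz⟩⟩

theorem Rule.not_mem_frontier {ρ : Rule S} {i : Fin ρ.branching} {z : S.Var}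
    (hz : z ∈ ρ.exVars i) : z ∉ ρ.frontier :=
  fun h => hz.2 h.1

theorem Rule.skTerm_of_mem {ρ : Rule S} {i : Fin ρ.branching} {s : ρ.frontier → GTerm S}
    {z : S.Var} (h : z ∈ ρ.frontier) : ρ.skTerm i s z = s ⟨z, h⟩ :=
  dif_pos h

theorem Rule.skTerm_of_not_mem {ρ : Rule S} {i : Fin ρ.branching} {s : ρ.frontier → GTerm S}
    {z : S.Var} (h : z ∉ ρ.frontier) : ρ.skTerm i s z = .app ⟨ρ, i, z⟩ s :=
  dif_neg h

theorem Rule.outAt_finite (ρ : Rule S) (i : Fin ρ.branching) (s : ρ.frontier → GTerm S) :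
    (ρ.outAt i s).Finite := by
  have h : ρ.outAt i s = (fun a : Atom S S.Var => a.map (ρ.skTerm i s)) '' {a | a ∈ ρ.head i} := by
    ext A
    simp [Rule.outAt, eq_comm]
  rw [h]
  exact (List.finite_toSet _).image _

/-- The trigger with the substitution post-composed with `p`. -/
def Trigger.comp (t : Trigger S) (p : GTerm S → GTerm S) : Trigger S :=
  ⟨t.rule, fun x => p (t.subst x)⟩

/-- Replace every constant `c_x` by `θ x`. -/
def GTerm.subst (θ : S.Var → GTerm S) : GTerm S → GTerm S
  | .const (.uc x) => θ x
  | .const (.base n) => .const (.base n)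
  | .const .star => .const .star
  | .const (.fn f) => .const (.fn f)
  | .app f s => .app f (fun x => (s x).subst θ)

@[simp] theorem GTerm.subst_uc (θ : S.Var → GTerm S) (x : S.Var) :
    (GTerm.const (Const.uc x)).subst θ = θ x := by rw [GTerm.subst]

@[simp] theorem GTerm.subst_substUc' (θ : S.Var → GTerm S) (x : S.Var) :
    (substUc S x).subst θ = θ x := by rw [substUc, GTerm.subst_uc]

@[simp] theorem GTerm.subst_app (θ : S.Var → GTerm S) (f : FnSym S)
    (s : f.rule.frontier → GTerm S) :
    (GTerm.app f s).subst θ = .app f (fun x => (s x).subst θ) := by rw [GTerm.subst]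

theorem GTerm.subst_substUc (t : GTerm S) : t.subst (substUc S) = t := by
  induction t with
  | const c => cases c <;> simp [GTerm.subst, substUc]
  | app f s ih => simp [ih]

theorem Rule.skTerm_subst (θ : S.Var → GTerm S) (ρ : Rule S) (i : Fin ρ.branching)
    (s : ρ.frontier → GTerm S) (z : S.Var) :
    (ρ.skTerm i s z).subst θ = ρ.skTerm i (fun x => (s x).subst θ) z := by
  by_cases h : z ∈ ρ.frontier
  · rw [skTerm_of_mem h, skTerm_of_mem h]
  · rw [skTerm_of_not_mem h, skTerm_of_not_mem h, GTerm.subst_app]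

theorem Rule.outAt_subst (θ : S.Var → GTerm S) (ρ : Rule S) (i : Fin ρ.branching)
    (s : ρ.frontier → GTerm S) :
    ρ.outAt i (fun x => (s x).subst θ) = Atom.map (GTerm.subst θ) '' ρ.outAt i s := by
  ext A
  constructor
  · rintro ⟨a, ha, rfl⟩
    exact ⟨_, ⟨a, ha, rfl⟩,
      (Atom.map_map _ _ a).trans (Atom.map_congr fun k => ρ.skTerm_subst θ i s _)⟩
  · rintro ⟨_, ⟨a, ha, rfl⟩, rfl⟩
    exact ⟨a, ha, (Atom.map_map _ _ a).trans (Atom.map_congr fun k => ρ.skTerm_subst θ i s _)⟩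

theorem Trigger.outHc_comp_subst (θ : S.Var → GTerm S) (t : Trigger S) (hc : HeadChoice S) :
    (t.comp (GTerm.subst θ)).outHc hc = Atom.map (GTerm.subst θ) '' t.outHc hc :=
  t.rule.outAt_subst θ _ _

/-! ### Kin, birth facts and skeletons -/

/-- The subterms of a term together with all terms that are born at the same time as one of
them. -/
def GTerm.kin : GTerm S → Set (GTerm S)
  | .const c => {.const c}
  | .app f s => {t | ∃ z ∈ f.rule.exVars f.idx, t = .app ⟨f.rule, f.idx, z⟩ s} ∪ ⋃ x, (s x).kin

theorem GTerm.mem_kin_const {c : Const S} {t : GTerm S} :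
    t ∈ (GTerm.const c).kin ↔ t = .const c := by
  rw [GTerm.kin]; rfl

theorem GTerm.mem_kin_app {f : FnSym S} {s : f.rule.frontier → GTerm S} {t : GTerm S} :
    t ∈ (GTerm.app f s).kin ↔
      (∃ z ∈ f.rule.exVars f.idx, t = .app ⟨f.rule, f.idx, z⟩ s) ∨ ∃ x, t ∈ (s x).kin := by
  rw [GTerm.kin, Set.mem_union, Set.mem_iUnion]; rfl

theorem GTerm.kin_subset_of_mem {t u : GTerm S} (h : t ∈ u.kin) : t.kin ⊆ u.kin := by
  induction u with
  | const c => rw [mem_kin_const.1 h]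
  | app f s ih =>
    intro w hw
    rw [mem_kin_app] at h ⊢
    rcases h with ⟨z, hz, rfl⟩ | ⟨x, hx⟩
    · exact mem_kin_app.1 hw
    · exact Or.inr ⟨x, ih x hx hw⟩

theorem GTerm.kin_arg_subset {f : FnSym S} {s : f.rule.frontier → GTerm S} {u : GTerm S}
    (h : GTerm.app f s ∈ u.kin) (x : f.rule.frontier) : (s x).kin ⊆ u.kin :=
  fun _ hw => kin_subset_of_mem h (mem_kin_app.2 (Or.inr ⟨x, hw⟩))

theorem GTerm.sibling_mem_kin {f : FnSym S} {s : f.rule.frontier → GTerm S} {u : GTerm S}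
    (h : GTerm.app f s ∈ u.kin) {z : S.Var} (hz : z ∈ f.rule.exVars f.idx) :
    GTerm.app ⟨f.rule, f.idx, z⟩ s ∈ u.kin :=
  kin_subset_of_mem h (mem_kin_app.2 (Or.inl ⟨z, hz, rfl⟩))

theorem GTerm.var_mem_exVars {f : FnSym S} {s : f.rule.frontier → GTerm S} {u : GTerm S}
    (h : GTerm.app f s ∈ u.kin) : f.var ∈ f.rule.exVars f.idx := by
  induction u with
  | const c => cases mem_kin_const.1 h
  | app f' s' ih =>
    rcases mem_kin_app.1 h with ⟨z, hz, h⟩ | ⟨x, hx⟩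
    · cases h
      exact hz
    · exact ih x hx

theorem GTerm.mem_kin_subst {θ : S.Var → GTerm S} {t u : GTerm S} (h : t ∈ (u.subst θ).kin) :
    (∃ v ∈ u.kin, t = v.subst θ) ∨ ∃ z, GTerm.const (Const.uc z) ∈ u.kin ∧ t ∈ (θ z).kin := by
  induction u with
  | const c =>
    cases c with
    | uc z => exact Or.inr ⟨z, mem_kin_const.2 rfl, by simpa using h⟩
    | base n =>
      simp only [GTerm.subst] at h
      exact Or.inl ⟨_, mem_kin_const.2 rfl, by simp only [GTerm.subst]; exact mem_kin_const.1 h⟩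
    | star =>
      simp only [GTerm.subst] at h
      exact Or.inl ⟨_, mem_kin_const.2 rfl, by simp only [GTerm.subst]; exact mem_kin_const.1 h⟩
    | fn f =>
      simp only [GTerm.subst] at h
      exact Or.inl ⟨_, mem_kin_const.2 rfl, by simp only [GTerm.subst]; exact mem_kin_const.1 h⟩
  | app f s ih =>
    rw [subst_app, mem_kin_app] at h
    rcases h with ⟨z, hz, rfl⟩ | ⟨x, hx⟩
    · exact Or.inl ⟨_, mem_kin_app.2 (Or.inl ⟨z, hz, rfl⟩), by rw [subst_app]⟩
    · rcases ih x hx with ⟨v, hv, h⟩ | ⟨z, hz, h⟩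
      · exact Or.inl ⟨v, mem_kin_app.2 (Or.inr ⟨x, hv⟩), h⟩
      · exact Or.inr ⟨z, mem_kin_app.2 (Or.inr ⟨x, hz⟩), h⟩

/-- Constants are left out because `θ z` need not be its own kin: the outermost symbol of an
arbitrary term may carry a variable that is not existential. -/
theorem GTerm.subst_app_mem_kin {θ : S.Var → GTerm S} {f : FnSym S}
    {s : f.rule.frontier → GTerm S} {u : GTerm S} (h : GTerm.app f s ∈ u.kin) :
    (GTerm.app f s).subst θ ∈ (u.subst θ).kin := by
  induction u with
  | const c => cases mem_kin_const.1 h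
  | app f' s' ih =>
    rw [subst_app (f := f'), mem_kin_app]
    rcases mem_kin_app.1 h with ⟨z, hz, h⟩ | ⟨x, hx⟩
    · rw [h]
      exact Or.inl ⟨z, hz, by rw [subst_app]⟩
    · exact Or.inr ⟨x, ih x hx⟩

theorem GTerm.kin_subset_kin_subst {θ : S.Var → GTerm S} {z : S.Var} {u : GTerm S}
    (h : GTerm.const (Const.uc z) ∈ u.kin) : (θ z).kin ⊆ (u.subst θ).kin := by
  induction u with
  | const c =>
    cases mem_kin_const.1 h
    rw [subst_uc]
  | app f' s' ih =>
    intro w hw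
    rw [subst_app, mem_kin_app]
    rcases mem_kin_app.1 h with ⟨z, hz, h⟩ | ⟨x, hx⟩
    · cases h
    · exact Or.inr ⟨x, ih x hx hw⟩

theorem GTerm.isTermOver_const (R : Set (Rule S)) (c : Const S) :
    (GTerm.const c).IsTermOver R := by
  intro f hf
  simp [GTerm.fnSyms] at hf

theorem GTerm.isTermOver_app {R : Set (Rule S)} {f : FnSym S} {s : f.rule.frontier → GTerm S} :
    (GTerm.app f s).IsTermOver R ↔
      (f.rule ∈ R ∧ f.var ∈ f.rule.exVars f.idx) ∧ ∀ x, (s x).IsTermOver R := by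
  constructor
  · intro h
    refine ⟨?_, fun x g hg => h g ?_⟩
    · obtain ⟨ρ, hρ, rfl, hf⟩ := h f (by simp [GTerm.fnSyms])
      exact ⟨hρ, hf⟩
    · rw [GTerm.fnSyms]
      exact Or.inr (Set.mem_iUnion.2 ⟨x, hg⟩)
  · rintro ⟨⟨h1, h2⟩, h3⟩ g hg
    rw [GTerm.fnSyms] at hg
    rcases hg with hg | hg
    · rw [Set.mem_singleton_iff.1 hg]
      exact ⟨_, h1, rfl, h2⟩
    · obtain ⟨x, hx⟩ := Set.mem_iUnion.1 hg
      exact h3 x g hx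

theorem GTerm.IsTermOver.self_mem_kin {R : Set (Rule S)} {t : GTerm S} (h : t.IsTermOver R) :
    t ∈ t.kin := by
  cases t with
  | const c => exact mem_kin_const.2 rfl
  | app f s => exact mem_kin_app.2 (Or.inl ⟨f.var, (isTermOver_app.1 h).1.2, rfl⟩)

theorem GTerm.IsTermOver.of_mem_kin {R : Set (Rule S)} {t u : GTerm S} (h : u.IsTermOver R)
    (ht : t ∈ u.kin) : t.IsTermOver R := by
  induction u with
  | const c => rwa [mem_kin_const.1 ht]
  | app f s ih =>
    rw [isTermOver_app] at h
    rcases mem_kin_app.1 ht with ⟨z, hz, rfl⟩ | ⟨x, hx⟩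
    · exact isTermOver_app.2 ⟨⟨h.1.1, hz⟩, h.2⟩
    · exact ih x (h.2 x) hx

theorem GTerm.IsTermOver.subst {R : Set (Rule S)} {θ : S.Var → GTerm S} {t : GTerm S}
    (h : t.IsTermOver R) (hθ : ∀ z, GTerm.const (Const.uc z) ∈ t.kin → (θ z).IsTermOver R) :
    (t.subst θ).IsTermOver R := by
  induction t with
  | const c =>
    cases c with
    | uc z =>
      rw [subst_uc]
      exact hθ z (mem_kin_const.2 rfl)
    | base n => simpa only [GTerm.subst] using h
    | star => simpa only [GTerm.subst] using h
    | fn f => simpa only [GTerm.subst] using h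
  | app f s ih =>
    rw [isTermOver_app] at h
    rw [subst_app, isTermOver_app]
    exact ⟨h.1, fun x => ih x (h.2 x) fun z hz => hθ z (mem_kin_app.2 (Or.inr ⟨x, hz⟩))⟩

theorem GTerm.IsTermOver.subterms_subset_kin {R : Set (Rule S)} {t : GTerm S}
    (h : t.IsTermOver R) : t.subterms ⊆ t.kin := by
  induction t with
  | const c => rw [GTerm.subterms, GTerm.kin]
  | app f s ih =>
    have h' := isTermOver_app.1 h
    rw [GTerm.subterms]
    rintro w (hw | hw)
    · rw [Set.mem_singleton_iff.1 hw]
      exact h.self_mem_kin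
    · obtain ⟨x, hx⟩ := Set.mem_iUnion.1 hw
      exact mem_kin_app.2 (Or.inr ⟨x, ih x (h'.2 x) hx⟩)

theorem GTerm.self_mem_subterms (t : GTerm S) : t ∈ t.subterms := by
  cases t <;> simp [GTerm.subterms]

theorem GTerm.IsTermOver.args_mem_kin {R : Set (Rule S)} {u : GTerm S} (h : u.IsTermOver R)
    {A : Fact S} (hA : A ∈ u.birthFacts) (k : Fin (S.ar A.pred)) : A.args k ∈ u.kin := by
  induction u with
  | const c => simp [GTerm.birthFacts] at hA
  | app f s ih =>
    rw [isTermOver_app] at h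
    rw [GTerm.birthFacts] at hA
    rw [mem_kin_app]
    rcases hA with ⟨a, ha, rfl⟩ | hA
    · by_cases hz : a.args k ∈ f.rule.frontier
      · refine Or.inr ⟨⟨_, hz⟩, ?_⟩
        change f.rule.skTerm f.idx s (a.args k) ∈ _
        rw [Rule.skTerm_of_mem hz]
        exact (h.2 _).self_mem_kin
      · exact Or.inl ⟨_, Rule.mem_exVars (mem_varsOf ha k) hz, Rule.skTerm_of_not_mem hz⟩
    · obtain ⟨x, hx⟩ := Set.mem_iUnion.1 hA
      exact Or.inr ⟨x, ih x (h.2 x) hx⟩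

theorem GTerm.IsTermOver.predOccurs {R : Set (Rule S)} {u : GTerm S} (h : u.IsTermOver R)
    {A : Fact S} (hA : A ∈ u.birthFacts) : PredOccurs R A.pred := by
  induction u with
  | const c => simp [GTerm.birthFacts] at hA
  | app f s ih =>
    rw [isTermOver_app] at h
    rw [GTerm.birthFacts] at hA
    rcases hA with ⟨a, ha, rfl⟩ | hA
    · exact ⟨_, h.1.1, a, Or.inr ⟨_, ha⟩, rfl⟩
    · obtain ⟨x, hx⟩ := Set.mem_iUnion.1 hA
      exact ih x (h.2 x) hx

theorem GTerm.mem_birthFacts_subst {θ : S.Var → GTerm S} {A : Fact S} {u : GTerm S}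
    (h : A ∈ (u.subst θ).birthFacts) : (∃ B ∈ u.birthFacts, A = B.map (GTerm.subst θ)) ∨
      ∃ z, GTerm.const (Const.uc z) ∈ u.kin ∧ A ∈ (θ z).birthFacts := by
  induction u with
  | const c =>
    cases c with
    | uc z => exact Or.inr ⟨z, mem_kin_const.2 rfl, by simpa using h⟩
    | base n => simp [GTerm.subst, GTerm.birthFacts] at h
    | star => simp [GTerm.subst, GTerm.birthFacts] at h
    | fn f => simp [GTerm.subst, GTerm.birthFacts] at h
  | app f s ih =>
    rw [subst_app, GTerm.birthFacts] at h
    rw [GTerm.birthFacts]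
    rcases h with h | h
    · rw [Rule.outAt_subst θ f.rule f.idx s] at h
      obtain ⟨B, hB, rfl⟩ := h
      exact Or.inl ⟨B, Or.inl hB, rfl⟩
    · obtain ⟨x, hx⟩ := Set.mem_iUnion.1 h
      rcases ih x hx with ⟨B, hB, h⟩ | ⟨z, hz, h⟩
      · exact Or.inl ⟨B, Or.inr (Set.mem_iUnion.2 ⟨x, hB⟩), h⟩
      · exact Or.inr ⟨z, mem_kin_app.2 (Or.inr ⟨x, hz⟩), h⟩

theorem GTerm.subterms_sibling_subset {f : FnSym S} {s : f.rule.frontier → GTerm S}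
    {z : S.Var} (hz : z ∈ f.rule.exVars f.idx) :
    (GTerm.app ⟨f.rule, f.idx, z⟩ s).subterms ⊆ termsOf (GTerm.app f s).birthFacts := by
  intro t ht
  obtain ⟨a, ha, k, rfl⟩ := hz.1
  refine ⟨a.map (f.rule.skTerm f.idx s), ?_, k, ?_⟩
  · rw [GTerm.birthFacts]
    exact Or.inl ⟨a, ha, rfl⟩
  · change t ∈ (f.rule.skTerm f.idx s (a.args k)).subterms
    rwa [Rule.skTerm_of_not_mem (Rule.not_mem_frontier hz)]

/-- An existential variable occurs in its head disjunct, so the birth facts of a functional term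
mention it, its siblings and its arguments. A constant has no birth facts, which is why skeletons
add the frontier constants separately. -/
theorem GTerm.IsTermOver.mem_termsOf_or {R : Set (Rule S)} {t u : GTerm S} (h : u.IsTermOver R)
    (ht : t ∈ u.kin) : t ∈ termsOf u.birthFacts ∨ t = u ∧ ∃ c, u = .const c := by
  induction u with
  | const c => exact Or.inr ⟨mem_kin_const.1 ht, c, rfl⟩
  | app f s ih =>
    have h' := isTermOver_app.1 h
    left
    rcases mem_kin_app.1 ht with ⟨z, hz, rfl⟩ | ⟨x, hx⟩
    · exact subterms_sibling_subset hz (self_mem_subterms _)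
    · rcases ih x (h'.2 x) hx with ⟨A, hA, k, hk⟩ | ⟨rfl, -⟩
      · refine ⟨A, ?_, k, hk⟩
        rw [GTerm.birthFacts]
        exact Or.inr (Set.mem_iUnion.2 ⟨x, hA⟩)
      · refine subterms_sibling_subset h'.1.2 ?_
        rw [GTerm.subterms]
        exact Or.inr (Set.mem_iUnion.2 ⟨x, self_mem_subterms _⟩)

/-- The skeleton of a trigger over `R` consists of the kin of its frontier terms. -/
theorem Trigger.IsTriggerOf.mem_skeleton_iff {R : Set (Rule S)} {t : Trigger S}
    (ht : t.IsTriggerOf R) {u : GTerm S} :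
    u ∈ t.skeleton ↔ ∃ x ∈ t.rule.frontier, u ∈ (t.subst x).kin := by
  constructor
  · rintro (⟨A, hA, k, hk⟩ | ⟨c, rfl, x, hx, h⟩)
    · obtain ⟨x, hx, hA⟩ := Set.mem_iUnion₂.1 hA
      have hR := ht.2 x hx.1
      have hk' := hR.args_mem_kin hA k
      exact ⟨x, hx, GTerm.kin_subset_of_mem hk' ((hR.of_mem_kin hk').subterms_subset_kin hk)⟩
    · exact ⟨x, hx, by rw [h]; exact GTerm.mem_kin_const.2 rfl⟩
  · rintro ⟨x, hx, hu⟩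
    rcases (ht.2 x hx.1).mem_termsOf_or hu with ⟨A, hA, k, hk⟩ | ⟨rfl, c, hc⟩
    · exact Or.inl ⟨A, Set.mem_iUnion₂.2 ⟨x, hx, hA⟩, k, hk⟩
    · exact Or.inr ⟨c, hc, x, hx, rfl⟩

theorem Trigger.IsTriggerOf.subst_mem_skeleton {R : Set (Rule S)} {t : Trigger S}
    (ht : t.IsTriggerOf R) {x : S.Var} (hx : x ∈ t.rule.frontier) : t.subst x ∈ t.skeleton :=
  ht.mem_skeleton_iff.2 ⟨x, hx, (ht.2 x hx.1).self_mem_kin⟩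

theorem Trigger.IsTriggerOf.kin_subset_skeleton {R : Set (Rule S)} {t : Trigger S}
    (ht : t.IsTriggerOf R) {u : GTerm S} (hu : u ∈ t.skeleton) : u.kin ⊆ t.skeleton := by
  intro w hw
  obtain ⟨x, hx, h⟩ := ht.mem_skeleton_iff.1 hu
  exact ht.mem_skeleton_iff.2 ⟨x, hx, GTerm.kin_subset_of_mem h hw⟩

theorem Trigger.IsTriggerOf.isTermOver {R : Set (Rule S)} {t : Trigger S}
    (ht : t.IsTriggerOf R) {u : GTerm S} (hu : u ∈ t.skeleton) : u.IsTermOver R := by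
  obtain ⟨x, hx, h⟩ := ht.mem_skeleton_iff.1 hu
  exact (ht.2 x hx.1).of_mem_kin h

theorem Trigger.IsTriggerOf.arg_mem_skeleton {R : Set (Rule S)} {t : Trigger S}
    (ht : t.IsTriggerOf R) {f : FnSym S} {s : f.rule.frontier → GTerm S}
    (h : GTerm.app f s ∈ t.skeleton) (x : f.rule.frontier) : s x ∈ t.skeleton := by
  have hR := ht.isTermOver h
  exact ht.kin_subset_skeleton h
    (GTerm.mem_kin_app.2 (Or.inr ⟨x, ((GTerm.isTermOver_app.1 hR).2 x).self_mem_kin⟩))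

/-! ### The abstraction `h^uc` and its marks -/

/-- The constants `⋆` and `c_f`. -/
def GTerm.IsMark (t : GTerm S) : Prop :=
  t = .const .star ∨ ∃ f, t = .const (.fn f)

/-- Triggers whose skeleton contains none of the constants `⋆` and `c_f`. -/
def Trigger.Unmarked (t : Trigger S) : Prop :=
  ∀ u ∈ t.skeleton, ¬ u.IsMark

theorem GTerm.IsMark.isTermOver {t : GTerm S} (h : t.IsMark) (R : Set (Rule S)) :
    t.IsTermOver R := by
  rcases h with rfl | ⟨f, rfl⟩ <;> exact isTermOver_const R _

theorem GTerm.not_isMark_app (f : FnSym S) (s : f.rule.frontier → GTerm S) :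
    ¬ (GTerm.app f s).IsMark := by
  rintro (h | ⟨g, h⟩) <;> cases h

theorem Trigger.hUc_of_mem {t : Trigger S} {u : GTerm S} (h : u ∈ t.skeleton) : t.hUc u = u :=
  if_pos h

theorem Trigger.hUc_app {t : Trigger S} {f : FnSym S} {s : f.rule.frontier → GTerm S}
    (h : GTerm.app f s ∉ t.skeleton) : t.hUc (.app f s) = .const (.fn f) :=
  if_neg h

theorem Trigger.hUc_const_uc {t : Trigger S} {x : S.Var}
    (h : GTerm.const (Const.uc x) ∉ t.skeleton) :
    t.hUc (.const (.uc x)) = .const .star :=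
  if_neg h

theorem Trigger.hUc_of_isMark {t : Trigger S} {u : GTerm S} (h : u.IsMark) : t.hUc u = u := by
  by_cases hu : u ∈ t.skeleton
  · exact hUc_of_mem hu
  · rcases h with rfl | ⟨f, rfl⟩ <;> exact if_neg hu

theorem Trigger.hUc_mem_or {t : Trigger S} (u : GTerm S) :
    t.hUc u ∈ t.skeleton ∨ (t.hUc u).IsMark := by
  by_cases hu : u ∈ t.skeleton
  · rw [hUc_of_mem hu]
    exact Or.inl hu
  · right
    cases u with
    | app f s => exact Or.inr ⟨f, hUc_app hu⟩
    | const c =>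
      cases c with
      | fn f => exact Or.inr ⟨f, if_neg hu⟩
      | _ => exact Or.inl (if_neg hu)

theorem Trigger.hUc_hUc {t : Trigger S} (u : GTerm S) : t.hUc (t.hUc u) = t.hUc u := by
  rcases t.hUc_mem_or u with h | h
  · exact hUc_of_mem h
  · exact hUc_of_isMark h

/-- Terms outside the skeleton become marks; if the skeleton has no marks, no foreign term can be
confused with a skeleton term. -/
theorem Trigger.Unmarked.hUc_eq {t : Trigger S} (ht : t.Unmarked) {u : GTerm S}
    (h : t.hUc u ∈ t.skeleton) : t.hUc u = u := by
  by_cases hu : u ∈ t.skeleton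
  · exact hUc_of_mem hu
  · exfalso
    refine ht _ h ?_
    cases u with
    | app f s => exact Or.inr ⟨f, hUc_app hu⟩
    | const c =>
      cases c with
      | fn f => exact Or.inr ⟨f, if_neg hu⟩
      | _ => exact Or.inl (if_neg hu)

theorem Trigger.IsTriggerOf.args_outHc {R : Set (Rule S)} {t : Trigger S}
    (ht : t.IsTriggerOf R) {hc : HeadChoice S} {A : Fact S} (hA : A ∈ t.outHc hc)
    (k : Fin (S.ar A.pred)) :
    A.args k ∈ t.skeleton ∨ ∃ f s, A.args k = GTerm.app f s ∧ ∀ x, s x ∈ t.skeleton := by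
  obtain ⟨a, ha, rfl⟩ := hA
  change t.rule.skTerm _ _ (a.args k) ∈ _ ∨ ∃ f s, t.rule.skTerm _ _ (a.args k) = _ ∧ _
  by_cases hz : a.args k ∈ t.rule.frontier
  · rw [Rule.skTerm_of_mem hz]
    exact Or.inl (ht.subst_mem_skeleton hz)
  · rw [Rule.skTerm_of_not_mem hz]
    exact Or.inr ⟨_, _, rfl, fun x => ht.subst_mem_skeleton x.2⟩

/-- If `k` maps the frontier of `t` into the skeleton of `l` and the marks, and `subst θ` is an
inverse of `k` on the skeleton, then `k` cannot make the outputs of `t` and `l` equal unless they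
are related by `subst θ`. -/
theorem Trigger.IsTriggerOf.outHc_eq {R : Set (Rule S)} {l t : Trigger S} (hl : l.IsTriggerOf R)
    {hc : HeadChoice S} {k : GTerm S → GTerm S} {θ : S.Var → GTerm S}
    (hk : ∀ x ∈ t.rule.frontier, k (t.subst x) ∈ l.skeleton ∨ (k (t.subst x)).IsMark)
    (hθ : ∀ x ∈ t.rule.frontier, k (t.subst x) ∈ l.skeleton →
      (k (t.subst x)).subst θ = t.subst x)
    (h : (t.comp k).outHc hc = l.outHc hc) :
    t.outHc hc = (l.comp (GTerm.subst θ)).outHc hc := by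
  rw [outHc_comp_subst, ← h, ← outHc_comp_subst]
  have key : ∀ a ∈ t.rule.head (hc t.rule), ∀ j,
      t.rule.skTerm (hc t.rule) (fun x => t.subst x) (a.args j) =
      t.rule.skTerm (hc t.rule) (fun x => (k (t.subst x)).subst θ) (a.args j) := by
    intro a ha j
    -- As a fact of the output of `l`, its arguments are skeleton terms or functional terms over the
    -- skeleton. This forces the `k`-values that occur in it into the skeleton, where `subst θ`
    -- undoes `k`.
    have hA : a.map (t.rule.skTerm (hc t.rule) (fun x => k (t.subst x))) ∈ l.outHc hc := by
      rw [← h]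
      exact ⟨a, ha, rfl⟩
    have hj := hl.args_outHc hA j
    change t.rule.skTerm _ _ (a.args j) ∈ _ ∨
      ∃ f s, t.rule.skTerm _ _ (a.args j) = GTerm.app f s ∧ _ at hj
    by_cases hz : a.args j ∈ t.rule.frontier
    · rw [Rule.skTerm_of_mem hz] at hj
      rw [Rule.skTerm_of_mem hz, Rule.skTerm_of_mem hz]
      refine (hθ _ hz ?_).symm
      rcases hk _ hz with h1 | h1
      · exact h1
      · rcases hj with hj | ⟨f, s, hj, -⟩
        · exact hj
        · exact absurd (hj ▸ h1) (GTerm.not_isMark_app f s)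
    · rw [Rule.skTerm_of_not_mem hz] at hj
      rw [Rule.skTerm_of_not_mem hz, Rule.skTerm_of_not_mem hz]
      congr 1
      funext x
      refine (hθ _ x.2 ?_).symm
      rcases hj with hj | ⟨f, s, hj, hs⟩
      · exact hl.arg_mem_skeleton hj x
      · cases hj
        exact hs x
  ext A
  constructor
  · rintro ⟨a, ha, rfl⟩
    exact ⟨a, ha, Atom.map_congr (key a ha)⟩
  · rintro ⟨a, ha, rfl⟩
    exact ⟨a, ha, (Atom.map_congr (key a ha)).symm⟩

theorem Trigger.comp_isTriggerOf {R : Set (Rule S)} {t : Trigger S} (ht : t.IsTriggerOf R)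
    {k : GTerm S → GTerm S} (hk : ∀ x ∈ t.rule.bodyVars, (k (t.subst x)).IsTermOver R) :
    (t.comp k).IsTriggerOf R :=
  ⟨ht.1, hk⟩

theorem Trigger.IsTriggerOf.hUc_isTermOver {R : Set (Rule S)} {l : Trigger S}
    (hl : l.IsTriggerOf R) (u : GTerm S) : (l.hUc u).IsTermOver R := by
  rcases l.hUc_mem_or u with h | h
  · exact hl.isTermOver h
  · exact h.isTermOver R

/-- The step rule of the over-approximation, with `t'` only loaded modulo `h^uc`. -/
theorem OverApprox.step_of_hUc {R : Set (Rule S)} {hc : HeadChoice S} {l t : Trigger S}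
    (hl : l.IsTriggerOf R) (hu : l.Unmarked) (ht : t.IsTriggerOf R)
    (hb : ∀ a ∈ t.rule.body, OverApprox R hc l ((a.map t.subst).map l.hUc))
    (hne : t.outHc hc ≠ l.outHc hc) {A : Fact S} (hA : A ∈ t.outHc hc) :
    OverApprox R hc l (A.map l.hUc) := by
  obtain ⟨a, ha, rfl⟩ := hA
  have key := OverApprox.step (t.comp l.hUc)
    (Trigger.comp_isTriggerOf ht fun x _ => hl.hUc_isTermOver _) hb ?_
    (a.map (t.rule.skTerm (hc t.rule) fun x => l.hUc (t.subst x))) ⟨a, ha, rfl⟩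
  · convert key using 1
    rw [Atom.map_map, Atom.map_map]
    refine Atom.map_congr fun k => ?_
    by_cases hz : a.args k ∈ t.rule.frontier
    · rw [Rule.skTerm_of_mem hz, Rule.skTerm_of_mem hz, l.hUc_hUc]
    · rw [Rule.skTerm_of_not_mem hz, Rule.skTerm_of_not_mem hz]
      -- Abstracting the arguments does not affect membership of the Skolem term in the skeleton,
      -- since the arguments of a skeleton term are fixed by `h^uc`. Outside the skeleton both
      -- versions collapse to the same `c_f`.
      by_cases h1 : GTerm.app ⟨t.rule, hc t.rule, a.args k⟩
          (fun x : t.rule.frontier => l.hUc (t.subst x)) ∈ l.skeleton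
      · congr 2
        funext x
        exact (hu.hUc_eq (hl.arg_mem_skeleton h1 x)).symm
      · rw [Trigger.hUc_app h1, Trigger.hUc_app]
        intro h2
        apply h1
        convert h2 using 2
        funext x
        exact Trigger.hUc_of_mem (hl.arg_mem_skeleton h2 x)
  · intro h
    apply hne
    -- Substituting along `substUc S` is the identity, so equal abstracted outputs already mean
    -- equal outputs.
    have := hl.outHc_eq (θ := substUc S) (fun x _ => l.hUc_mem_or _)
      (fun x _ hx => by rw [GTerm.subst_substUc, hu.hUc_eq hx]) h
    rw [this, Trigger.outHc_comp_subst]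
    have e : Atom.map (GTerm.subst (substUc S)) = (id : Fact S → Fact S) :=
      funext fun A => congrArg (Atom.mk A.pred) (funext fun k => GTerm.subst_substUc _)
    rw [e, Set.image_id]

end Basics

/-! ### The `hc`-branch of a chase tree and the frozen database -/

section Chase

variable {S : Signature.{u, v}}

/-- The fact sets that label the vertices of a chase tree for `⟨R, D⟩` which are reached from the
root by always moving to the child selected by `hc`. -/
inductive HcDerivation (R : Set (Rule S)) (hc : HeadChoice S) (D : Set (Fact S)) :
    Set (Fact S) → Prop
  | root : HcDerivation R hc D D
  | step (F : Set (Fact S)) (hF : HcDerivation R hc D F) (t : Trigger S) (ht : t.IsTriggerOf R)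
      (hl : t.Loaded F) (ho : ¬ t.Obsolete F) : HcDerivation R hc D (F ∪ t.outHc hc)

theorem HcDerivation.subset {R : Set (Rule S)} {hc : HeadChoice S} {D F : Set (Fact S)}
    (h : HcDerivation R hc D F) : D ⊆ F := by
  induction h with
  | root => exact subset_rfl
  | step F hF t ht hl ho ih => exact ih.trans Set.subset_union_left

theorem HcDerivation.finite {R : Set (Rule S)} {hc : HeadChoice S} {D F : Set (Fact S)}
    (h : HcDerivation R hc D F) (hD : D.Finite) : F.Finite := by
  induction h with
  | root => exact hD
  | step F hF t ht hl ho ih => exact ih.union (t.rule.outAt_finite _ _)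

/-- In a finite chase tree, the children selected by `hc` lead to a leaf. -/
theorem ChaseTree.exists_hcDerivation {R : Set (Rule S)} {D : Set (Fact S)} (T : ChaseTree R D)
    (hT : Finite T.V) (hc : HeadChoice S) :
    ∃ F, HcDerivation R hc D F ∧ ∀ ψ ∈ R, Satisfies F ψ := by
  by_contra hno
  have hstep : ∀ x : {x : T.V // HcDerivation R hc D (T.fct x)},
      ∃ y : {x : T.V // HcDerivation R hc D (T.fct x)}, T.E x y := by
    rintro ⟨x, hx⟩
    have hE : ∃ y, T.E x y := by
      by_contra h
      exact hno ⟨_, hx, T.leaf x h⟩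
    obtain ⟨t, ht, hl, ho, -, c, -, hEc, hf⟩ := T.step x hE
    refine ⟨⟨(c (hc t.rule)).1, ?_⟩, (hEc _).2 ⟨_, rfl⟩⟩
    rw [(hf _).1]
    exact .step _ hx t ht hl ho
  choose next hnext using hstep
  let p : ℕ → {x : T.V // HcDerivation R hc D (T.fct x)} :=
    fun n => Nat.rec ⟨T.root, T.fct_root.symm ▸ .root⟩ (fun _ x => next x) n
  have hp : ∀ n, T.E (p n).1 (p (n + 1)).1 := fun n => hnext (p n)
  -- Parents are unique and the root has none, so a repeated vertex could be traced back to the root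
  -- at two different depths.
  have hinj : ∀ m n, (p m).1 = (p n).1 → m = n := by
    intro m
    induction m with
    | zero =>
      intro n h
      cases n with
      | zero => rfl
      | succ n => exact absurd (h ▸ hp n) (T.not_edge_root _)
    | succ m ih =>
      intro n h
      cases n with
      | zero => exact absurd (h ▸ hp m) (T.not_edge_root _)
      | succ n => rw [ih n (T.parent_unique _ _ _ (hp m) (h ▸ hp n))]
  exact not_injective_infinite_finite (fun n => (p n).1) fun m n h => hinj m n h

/-- The database of `ρ` for the `i`-th disjunct: the facts of the body and of this disjunct under
`x ↦ c_x`. -/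
def Rule.headDatabase (ρ : Rule S) (i : Fin ρ.branching) : Set (Fact S) :=
  {A | ∃ a, (a ∈ ρ.body ∨ a ∈ ρ.head i) ∧ A = a.map (substUc S)}

theorem Rule.headDatabase_finite (ρ : Rule S) (i : Fin ρ.branching) :
    (ρ.headDatabase i).Finite := by
  have h : ρ.headDatabase i =
      (fun a : Atom S S.Var => a.map (substUc S)) '' {a | a ∈ ρ.body ++ ρ.head i} := by
    ext A
    simp [Rule.headDatabase, eq_comm]
  rw [h]
  exact (List.finite_toSet _).image _

theorem Rule.headDatabase_functionFree (ρ : Rule S) (i : Fin ρ.branching) :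
    FunctionFree (ρ.headDatabase i) := by
  rintro _ ⟨a, -, rfl⟩ k
  exact ⟨_, rfl⟩

open Classical in
/-- The substitution that replaces `c_y`, for each existentially quantified variable `y` of the
`i`-th disjunct of `ρ`, by the Skolem term for `y` that is born from `x ↦ c_x`. -/
noncomputable def Rule.unfreeze (ρ : Rule S) (i : Fin ρ.branching) (z : S.Var) : GTerm S :=
  if z ∈ ρ.exVars i then .app ⟨ρ, i, z⟩ (fun x => substUc S x) else substUc S z

theorem Rule.unfreeze_of_mem {ρ : Rule S} {i : Fin ρ.branching} {z : S.Var}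
    (h : z ∈ ρ.exVars i) : ρ.unfreeze i z = .app ⟨ρ, i, z⟩ (fun x => substUc S x) :=
  if_pos h

theorem Rule.unfreeze_of_not_mem {ρ : Rule S} {i : Fin ρ.branching} {z : S.Var}
    (h : z ∉ ρ.exVars i) : ρ.unfreeze i z = substUc S z :=
  if_neg h

theorem Rule.unfreeze_eq_skTerm {ρ : Rule S} {i : Fin ρ.branching} {z : S.Var}
    (h : z ∈ varsOf (ρ.head i)) :
    ρ.unfreeze i z = ρ.skTerm i (fun x => substUc S x) z := by
  by_cases hz : z ∈ ρ.frontier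
  · rw [skTerm_of_mem hz, unfreeze_of_not_mem fun he => not_mem_frontier he hz]
  · rw [skTerm_of_not_mem hz, unfreeze_of_mem (mem_exVars h hz)]

/-- Terms without a Skolem term of `ρ` that is born from `x ↦ c_x`. -/
def GTerm.Fresh (ρ : Rule S) (i : Fin ρ.branching) : GTerm S → Prop
  | .const _ => True
  | .app f s => (∀ z, GTerm.app f s ≠ .app ⟨ρ, i, z⟩ (fun x => substUc S x)) ∧
      ∀ x, (s x).Fresh ρ i

theorem GTerm.fresh_const (ρ : Rule S) (i : Fin ρ.branching) (c : Const S) :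
    (GTerm.const c).Fresh ρ i := by
  rw [GTerm.Fresh]; trivial

theorem GTerm.fresh_app {ρ : Rule S} {i : Fin ρ.branching} {f : FnSym S}
    {s : f.rule.frontier → GTerm S} : (GTerm.app f s).Fresh ρ i ↔
      (∀ z, GTerm.app f s ≠ .app ⟨ρ, i, z⟩ (fun x => substUc S x)) ∧ ∀ x, (s x).Fresh ρ i := by
  rw [GTerm.Fresh]

theorem GTerm.const_of_subst_unfreeze {ρ : Rule S} {i : Fin ρ.branching} {t : GTerm S}
    {x : S.Var} (h : t.subst (ρ.unfreeze i) = substUc S x) : t = substUc S x := by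
  cases t with
  | app f s => rw [subst_app] at h; cases h
  | const c =>
    cases c with
    | uc y =>
      rw [subst_uc] at h
      by_cases hy : y ∈ ρ.exVars i
      · rw [Rule.unfreeze_of_mem hy] at h; cases h
      · rwa [Rule.unfreeze_of_not_mem hy] at h
    | _ => simp only [GTerm.subst] at h; cases h

theorem GTerm.app_ne_subst_const {ρ : Rule S} {i : Fin ρ.branching} {f : FnSym S}
    {s : f.rule.frontier → GTerm S} (hf : (GTerm.app f s).Fresh ρ i) (c : Const S) :
    (GTerm.app f s).subst (ρ.unfreeze i) ≠ (GTerm.const c).subst (ρ.unfreeze i) := by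
  intro h
  rw [subst_app] at h
  cases c with
  | uc y =>
    rw [subst_uc] at h
    by_cases hy : y ∈ ρ.exVars i
    · rw [Rule.unfreeze_of_mem hy] at h
      obtain ⟨r, j, z⟩ := f
      injection h with h1 h2
      injection h1 with h3 h4 h5
      subst h3
      cases h4
      subst h5
      refine (fresh_app.1 hf).1 z ?_
      congr 1
      funext x
      exact const_of_subst_unfreeze (congrFun (eq_of_heq h2) x)
    · rw [Rule.unfreeze_of_not_mem hy] at h
      cases h
  | _ => simp only [GTerm.subst] at h; cases h

/-- The only possible collision is between a frozen `c_y` and the Skolem term that replaces it;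
freshness rules out the latter. -/
theorem GTerm.subst_unfreeze_injective {ρ : Rule S} {i : Fin ρ.branching} {t t' : GTerm S}
    (ht : t.Fresh ρ i) (ht' : t'.Fresh ρ i)
    (h : t.subst (ρ.unfreeze i) = t'.subst (ρ.unfreeze i)) : t = t' := by
  induction t generalizing t' with
  | const c =>
    cases t' with
    | app f s => exact absurd h.symm (app_ne_subst_const ht' c)
    | const c' =>
      cases c with
      | uc y =>
        by_cases hy : y ∈ ρ.exVars i
        · rw [subst_uc, Rule.unfreeze_of_mem hy] at h
          cases c' with
          | uc y' =>
            rw [subst_uc] at h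
            by_cases hy' : y' ∈ ρ.exVars i
            · rw [Rule.unfreeze_of_mem hy'] at h
              cases h
              rfl
            · rw [Rule.unfreeze_of_not_mem hy'] at h; cases h
          | _ => simp only [GTerm.subst] at h; cases h
        · rw [subst_uc, Rule.unfreeze_of_not_mem hy] at h
          exact (const_of_subst_unfreeze h.symm).symm
      | _ =>
        simp only [GTerm.subst] at h
        cases c' with
        | uc y' =>
          rw [subst_uc] at h
          by_cases hy' : y' ∈ ρ.exVars i
          · rw [Rule.unfreeze_of_mem hy'] at h; cases h
          · rw [Rule.unfreeze_of_not_mem hy'] at h; cases h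
        | _ => first | rfl | (simp only [GTerm.subst] at h; exact h)
  | app f s ih =>
    cases t' with
    | const c => exact absurd h (app_ne_subst_const ht c)
    | app f' s' =>
      rw [subst_app, subst_app] at h
      injection h with h1 h2
      subst h1
      congr 1
      funext x
      exact ih x ((fresh_app.1 ht).2 x) ((fresh_app.1 ht').2 x) (congrFun (eq_of_heq h2) x)

/-- The frozen constants `c_y` serve as witnesses for the existential variables of the `i`-th
disjunct. -/
theorem Rule.obsolete_of_headDatabase_subset {ρ : Rule S} {i : Fin ρ.branching}
    {σ : S.Var → GTerm S} {F : Set (Fact S)} (hF : ρ.headDatabase i ⊆ F)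
    (hσ : ∀ x ∈ ρ.frontier, σ x = substUc S x) : Trigger.Obsolete ⟨ρ, σ⟩ F := by
  classical
  refine ⟨fun x => if x ∈ ρ.bodyVars then σ x else substUc S x, fun x hx => if_pos hx, i, ?_⟩
  intro a ha
  have : a.map (fun x => if x ∈ ρ.bodyVars then σ x else substUc S x) = a.map (substUc S) := by
    refine Atom.map_congr fun k => ?_
    split_ifs with h
    · exact hσ _ ⟨h, i, mem_varsOf ha k⟩
    · rfl
  rw [this]
  exact hF ⟨a, Or.inr ha, rfl⟩

/-- A trigger that creates a forbidden Skolem term maps the frontier of `ρ` to the `c_x`, hence is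
obsolete and is never applied by the restricted chase. -/
theorem HcDerivation.fresh {R : Set (Rule S)} {hc : HeadChoice S} {ρ : Rule S}
    {i : Fin ρ.branching} {F : Set (Fact S)} (h : HcDerivation R hc (ρ.headDatabase i) F) :
    ∀ A ∈ F, ∀ k, (A.args k).Fresh ρ i := by
  induction h with
  | root =>
    intro A hA k
    obtain ⟨c, h⟩ := ρ.headDatabase_functionFree i A hA k
    rw [h]
    exact GTerm.fresh_const _ _ c
  | step F hF t ht hl ho ih =>
    have hbody : ∀ x ∈ t.rule.bodyVars, (t.subst x).Fresh ρ i := by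
      rintro x ⟨a, ha, k, rfl⟩
      exact ih _ (hl a ha) k
    rintro A (hA | ⟨a, ha, rfl⟩) k
    · exact ih A hA k
    · change (t.rule.skTerm _ _ (a.args k)).Fresh ρ i
      by_cases hz : a.args k ∈ t.rule.frontier
      · rw [Rule.skTerm_of_mem hz]
        exact hbody _ hz.1
      · rw [Rule.skTerm_of_not_mem hz, GTerm.fresh_app]
        refine ⟨fun z h => ho ?_, fun x => hbody _ x.2.1⟩
        obtain ⟨r, σ⟩ := t
        injection h with h1 h2
        injection h1 with h3 h4 h5
        subst h3
        exact Rule.obsolete_of_headDatabase_subset hF.subset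
          fun x hx => congrFun (eq_of_heq h2) ⟨x, hx⟩

/-- The chase facts, with the frozen Skolem terms restored. -/
abbrev unfrozen (ρ : Rule S) (i : Fin ρ.branching) (F : Set (Fact S)) : Set (Fact S) :=
  Atom.map (GTerm.subst (ρ.unfreeze i)) '' F

theorem map_unfreeze_body {ρ : Rule S} {i : Fin ρ.branching} {a : Atom S S.Var}
    (ha : a ∈ ρ.body) :
    (a.map (substUc S)).map (GTerm.subst (ρ.unfreeze i)) = a.map (substUc S) := by
  refine (Atom.map_map _ _ a).trans (Atom.map_congr fun k => ?_)
  rw [GTerm.subst_substUc', Rule.unfreeze_of_not_mem fun h => h.2 (mem_varsOf ha k)]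

theorem map_unfreeze_head {ρ : Rule S} {i : Fin ρ.branching} {a : Atom S S.Var}
    (ha : a ∈ ρ.head i) :
    (a.map (substUc S)).map (GTerm.subst (ρ.unfreeze i)) =
      a.map (ρ.skTerm i (fun x => substUc S x)) := by
  refine (Atom.map_map _ _ a).trans (Atom.map_congr fun k => ?_)
  rw [GTerm.subst_substUc', Rule.unfreeze_eq_skTerm (mem_varsOf ha k)]

theorem unfreeze_isTermOver {R : Set (Rule S)} {ρ : Rule S} (hρ : ρ ∈ R) (i : Fin ρ.branching)
    (z : S.Var) : (ρ.unfreeze i z).IsTermOver R := by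
  by_cases h : z ∈ ρ.exVars i
  · rw [Rule.unfreeze_of_mem h, GTerm.isTermOver_app]
    exact ⟨⟨hρ, h⟩, fun x => GTerm.isTermOver_const R _⟩
  · rw [Rule.unfreeze_of_not_mem h]
    exact GTerm.isTermOver_const R _

/-- The unfrozen chase facts are over-approximated as long as the output of `l` is missing. -/
theorem HcDerivation.overApprox {R : Set (Rule S)} {hc : HeadChoice S} {ρ : Rule S}
    (hρ : ρ ∈ R) {F : Set (Fact S)} (h : HcDerivation R hc (ρ.headDatabase (hc ρ)) F)
    {l : Trigger S} (hl : l.IsTriggerOf R) (hu : l.Unmarked)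
    (hout : ¬ l.outHc hc ⊆ unfrozen ρ (hc ρ) F) :
    ∀ A ∈ unfrozen ρ (hc ρ) F, OverApprox R hc l (A.map l.hUc) := by
  induction h with
  | root =>
    have hbody : ∀ a ∈ ρ.body, OverApprox R hc l ((a.map (substUc S)).map l.hUc) := by
      intro a ha
      refine .crit _ ⟨ρ, hρ, a, Or.inl ha, rfl⟩ fun k => ?_
      change ∃ c, l.hUc (.const (.uc (a.args k))) = _ ∧ (l.hUc (.const (.uc (a.args k))) ∈ _ ∨ _)
      by_cases h : GTerm.const (.uc (a.args k)) ∈ l.skeleton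
      · rw [Trigger.hUc_of_mem h]
        exact ⟨_, rfl, Or.inl h⟩
      · rw [Trigger.hUc_const_uc h]
        exact ⟨_, rfl, Or.inr rfl⟩
    rintro _ ⟨_, ⟨a, ha | ha, rfl⟩, rfl⟩
    · rw [map_unfreeze_body ha]
      exact hbody a ha
    · rw [map_unfreeze_head ha]
      -- Unfrozen head facts are the output of `⟨ρ, x ↦ c_x⟩`. This output differs from that of `l`,
      -- since it is present from the start and the output of `l` is missing.
      refine OverApprox.step_of_hUc hl hu (t := ⟨ρ, substUc S⟩)
        ⟨hρ, fun x _ => GTerm.isTermOver_const R _⟩ hbody ?_ ⟨a, ha, rfl⟩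
      intro h
      apply hout
      rw [← h]
      rintro _ ⟨b, hb, rfl⟩
      exact ⟨_, ⟨b, Or.inr hb, rfl⟩, map_unfreeze_head hb⟩
  | step F hF t ht hb ho ih =>
    have e : unfrozen ρ (hc ρ) (F ∪ t.outHc hc) = unfrozen ρ (hc ρ) F ∪
        (t.comp (GTerm.subst (ρ.unfreeze (hc ρ)))).outHc hc := by
      rw [Trigger.outHc_comp_subst, ← Set.image_union]
    rw [e] at hout ⊢
    have ih' := ih fun h => hout (h.trans Set.subset_union_left)
    rintro A (hA | hA)
    · exact ih' A hA
    · refine OverApprox.step_of_hUc hl hu (Trigger.comp_isTriggerOf ht fun x hx =>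
        (ht.2 x hx).subst fun z _ => unfreeze_isTermOver hρ _ z) ?_ ?_ hA
      · intro a ha
        exact ih' _ ⟨_, hb a ha, rfl⟩
      · intro h
        apply hout
        rw [← h]
        exact Set.subset_union_right

/-- Obsolescence is transported along `p`. Agreement on the frontier suffices, because these are the
only body variables that occur in a head. -/
theorem Trigger.obsolete_overApprox {R : Set (Rule S)} {hc : HeadChoice S} {l : Trigger S}
    {p : GTerm S → GTerm S} {σ : S.Var → GTerm S} {F : Set (Fact S)}
    (hp : ∀ x ∈ l.rule.frontier, p (σ x) = l.subst x)
    (hF : ∀ A ∈ F, OverApprox R hc l (A.map p)) (ho : Trigger.Obsolete ⟨l.rule, σ⟩ F) :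
    l.Obsolete {A | OverApprox R hc l A} := by
  classical
  obtain ⟨τ, hτ, i, h⟩ := ho
  refine ⟨fun x => if x ∈ l.rule.bodyVars then l.subst x else p (τ x), fun x hx => if_pos hx, i, ?_⟩
  intro a ha
  have : a.map (fun x => if x ∈ l.rule.bodyVars then l.subst x else p (τ x)) =
      (a.map τ).map p := by
    refine Eq.trans (Atom.map_congr fun k => ?_) (Atom.map_map _ _ a).symm
    split_ifs with hx
    · rw [hτ _ hx, hp _ ⟨hx, i, mem_varsOf ha k⟩]
    · rfl
  rw [this]
  exact hF _ (h a ha)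

theorem Trigger.outHc_subset_of_datalog {l : Trigger S} (hd : l.rule.IsDatalog)
    (hc : HeadChoice S) {F : Set (Fact S)} (ho : l.Obsolete F) : l.outHc hc ⊆ F := by
  obtain ⟨τ, hτ, i, h⟩ := ho
  have hi : hc l.rule = i := by
    have h1 : l.rule.branching = 1 := hd.1
    apply Fin.ext
    omega
  rintro _ ⟨a, ha, rfl⟩
  rw [hi] at ha ⊢
  have : a.map (l.rule.skTerm i fun x => l.subst x) = a.map τ := by
    refine Atom.map_congr fun k => ?_
    have hz : a.args k ∈ l.rule.frontier := by
      by_contra hz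
      exact hd.2 ⟨i, _, Rule.mem_exVars (mem_varsOf ha k) hz⟩
    rw [Rule.skTerm_of_mem hz, hτ _ hz.1]
  rw [this]
  exact h a ha

/-- Choose preimages in `F` of the terms of the trigger. Injectivity of unfreezing makes these
choices consistent across body atoms, so they form a trigger loaded for `F`; its obsolescence is
then unfrozen. -/
theorem HcDerivation.obsolete_unfrozen {R : Set (Rule S)} {hc : HeadChoice S} {ρ : Rule S}
    {i : Fin ρ.branching} {F : Set (Fact S)} (h : HcDerivation R hc (ρ.headDatabase i) F)
    (hsat : ∀ ψ ∈ R, Satisfies F ψ) {l : Trigger S} (hl : l.IsTriggerOf R)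
    (hb : l.Loaded (unfrozen ρ i F)) : l.Obsolete (unfrozen ρ i F) := by
  classical
  have hpre : ∀ x, ∃ t : GTerm S, x ∈ l.rule.bodyVars →
      t.Fresh ρ i ∧ t.subst (ρ.unfreeze i) = l.subst x := by
    intro x
    by_cases hx : x ∈ l.rule.bodyVars
    · obtain ⟨a, ha, k, rfl⟩ := hx
      obtain ⟨⟨p, B⟩, hB, he⟩ := hb a ha
      have hp : p = a.pred := congrArg Atom.pred he
      subst hp
      injection he with h1 h2
      exact ⟨B k, fun _ => ⟨h.fresh _ hB k, congrFun h2 k⟩⟩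
    · exact ⟨substUc S x, fun h => absurd h hx⟩
  choose σ hσ using hpre
  have hload : Trigger.Loaded ⟨l.rule, σ⟩ F := by
    intro a ha
    obtain ⟨B, hB, he⟩ := hb a ha
    have : B = a.map σ := by
      obtain ⟨p, B⟩ := B
      have hp : p = a.pred := congrArg Atom.pred he
      subst hp
      refine congrArg (Atom.mk _) (funext fun k => ?_)
      have hx := hσ _ (mem_varsOf ha k)
      refine GTerm.subst_unfreeze_injective (h.fresh _ hB k) hx.1 ?_
      rw [hx.2]
      injection he with h1 h2
      exact congrFun h2 k
    exact this ▸ hB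
  obtain ⟨τ, hτ, j, ho⟩ := hsat _ hl.1 ⟨l.rule, σ⟩ rfl hload
  refine ⟨fun x => (τ x).subst (ρ.unfreeze i), fun x hx => ?_, j, fun a ha => ⟨_, ho a ha, rfl⟩⟩
  change (τ x).subst _ = _
  rw [hτ x hx]
  exact (hσ x hx).2

/-- Saturated derivations contain the outputs of all loaded unblockable triggers. -/
theorem HcDerivation.outHc_subset {R : Set (Rule S)} {hc : HeadChoice S} {ρ : Rule S}
    (hρ : ρ ∈ R) {F : Set (Fact S)} (h : HcDerivation R hc (ρ.headDatabase (hc ρ)) F)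
    (hsat : ∀ ψ ∈ R, Satisfies F ψ) {l : Trigger S} (hl : l.IsTriggerOf R) (hu : l.Unmarked)
    (hb : l.Loaded (unfrozen ρ (hc ρ) F)) (hub : l.UcUnblockable R hc) :
    l.outHc hc ⊆ unfrozen ρ (hc ρ) F := by
  have ho := h.obsolete_unfrozen hsat hl hb
  rcases hub with hd | hn
  · exact Trigger.outHc_subset_of_datalog hd hc ho
  · by_contra hout
    exact hn (Trigger.obsolete_overApprox
      (fun x hx => Trigger.hUc_of_mem (hl.subst_mem_skeleton hx))
      (h.overApprox hρ hl hu hout) ho)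

end Chase

/-! ### Replaying unblockable triggers along a substitution -/

section Replay

variable {S : Signature.{u, v}}

/-- The terms that can occur in `RpcFacts R hc ρ` for `i = hc ρ`: the constants `c_x` for body
variables `x`, the Skolem terms of the `i`-th disjunct that are born from `x ↦ c_x`, and functional
terms with some functional argument. -/
inductive Grown (ρ : Rule S) (i : Fin ρ.branching) : GTerm S → Prop
  | uc (x : S.Var) (hx : x ∈ ρ.bodyVars) : Grown ρ i (substUc S x)
  | init (z : S.Var) (hz : z ∈ ρ.exVars i) : Grown ρ i (.app ⟨ρ, i, z⟩ (fun x => substUc S x))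
  | app (f : FnSym S) (s : f.rule.frontier → GTerm S) (hf : f.var ∈ f.rule.exVars f.idx)
      (hs : ∀ x, Grown ρ i (s x)) (hx : ∃ x f' s', s x = .app f' s') : Grown ρ i (.app f s)

theorem Grown.self_mem_kin {ρ : Rule S} {i : Fin ρ.branching} {t : GTerm S} (h : Grown ρ i t) :
    t ∈ t.kin := by
  cases h with
  | uc x hx => exact GTerm.mem_kin_const.2 rfl
  | init z hz => exact GTerm.mem_kin_app.2 (Or.inl ⟨z, hz, rfl⟩)
  | app f s hf hs hx => exact GTerm.mem_kin_app.2 (Or.inl ⟨f.var, hf, rfl⟩)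

theorem Grown.of_mem_kin {ρ : Rule S} {i : Fin ρ.branching} {t u : GTerm S} (h : Grown ρ i t)
    (hu : u ∈ t.kin) : Grown ρ i u := by
  induction h with
  | uc x hx =>
    rw [GTerm.mem_kin_const.1 hu]
    exact .uc x hx
  | init z hz =>
    rcases GTerm.mem_kin_app.1 hu with ⟨y, hy, rfl⟩ | ⟨x, hx⟩
    · exact .init y hy
    · rw [GTerm.mem_kin_const.1 hx]
      exact .uc (x : S.Var) (Subtype.property x).1
  | app f s hf hs hx ih =>
    rcases GTerm.mem_kin_app.1 hu with ⟨y, hy, rfl⟩ | ⟨x, hx⟩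
    · exact .app ⟨f.rule, f.idx, y⟩ s hy hs hx
    · exact ih x hx

theorem Grown.mem_bodyVars {ρ : Rule S} {i : Fin ρ.branching} {x : S.Var}
    (h : Grown ρ i (.const (.uc x))) : x ∈ ρ.bodyVars := by
  generalize ht : GTerm.const (Const.uc x) = t at h
  cases h with
  | uc y hy => cases ht; exact hy
  | _ => cases ht

theorem Grown.exists_eq_substUc {ρ : Rule S} {i : Fin ρ.branching} {c : Const S}
    (h : Grown ρ i (.const c)) : ∃ x ∈ ρ.bodyVars, c = .uc x := by
  generalize ht : GTerm.const c = t at h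
  cases h with
  | uc y hy => cases ht; exact ⟨y, hy, rfl⟩
  | _ => cases ht

theorem Grown.not_isMark {ρ : Rule S} {i : Fin ρ.branching} {t : GTerm S} (h : Grown ρ i t) :
    ¬ t.IsMark := by
  rintro (rfl | ⟨f, rfl⟩) <;> obtain ⟨x, -, h⟩ := h.exists_eq_substUc <;> cases h

theorem Grown.exists_init {ρ : Rule S} {i : Fin ρ.branching} {t : GTerm S} (h : Grown ρ i t)
    (ht : ∃ f s, t = .app f s) : ∃ z, GTerm.app ⟨ρ, i, z⟩ (fun x => substUc S x) ∈ t.kin := by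
  induction h with
  | uc x hx =>
    obtain ⟨f, s, h⟩ := ht
    cases h
  | init z hz => exact ⟨z, (Grown.init z hz).self_mem_kin⟩
  | app f s hf hs hx ih =>
    obtain ⟨x, hx⟩ := hx
    obtain ⟨z, hz⟩ := ih x hx
    exact ⟨z, GTerm.mem_kin_app.2 (Or.inr ⟨x, hz⟩)⟩

/-- Substitutions along which the derivation of `RpcFacts R hc ρ` can be replayed. -/
structure Replayable (R : Set (Rule S)) (ρ : Rule S) (i : Fin ρ.branching)
    (θ : S.Var → GTerm S) : Prop where
  inj : Set.InjOn θ ρ.bodyVars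
  fresh : ∀ x ∈ ρ.bodyVars, ∀ z, GTerm.app ⟨ρ, i, z⟩ (fun x => θ x) ∉ (θ x).kin
  isTermOver : ∀ x ∈ ρ.bodyVars, (θ x).IsTermOver R
  unmarked : ∀ x ∈ ρ.bodyVars, ∀ u ∈ (θ x).kin, ¬ u.IsMark

/-- Every functional grown term has an initial Skolem term of `ρ` among its kin, and the image of
that one is excluded by freshness. -/
theorem Replayable.init_not_mem {R : Set (Rule S)} {ρ : Rule S} {i : Fin ρ.branching}
    {θ : S.Var → GTerm S} (hθ : Replayable R ρ i θ) {x : S.Var} (hx : x ∈ ρ.bodyVars)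
    {f : FnSym S} {s : f.rule.frontier → GTerm S} (h : Grown ρ i (.app f s)) :
    (GTerm.app f s).subst θ ∉ (θ x).kin := by
  intro hm
  obtain ⟨z, hz⟩ := h.exists_init ⟨f, s, rfl⟩
  have h1 := GTerm.kin_subset_of_mem hm (GTerm.subst_app_mem_kin (θ := θ) hz)
  rw [GTerm.subst_app] at h1
  simp only [GTerm.subst_substUc'] at h1
  exact hθ.fresh x hx z h1

/-- Constants are separated by injectivity of `θ`, and a functional term cannot collapse onto some
`θ x` by `init_not_mem`; the rest is structural induction. -/
theorem Replayable.subst_injective {R : Set (Rule S)} {ρ : Rule S} {i : Fin ρ.branching}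
    {θ : S.Var → GTerm S} (hθ : Replayable R ρ i θ) {t t' : GTerm S} (ht : Grown ρ i t)
    (ht' : Grown ρ i t') (h : t.subst θ = t'.subst θ) : t = t' := by
  have key : ∀ x ∈ ρ.bodyVars, ∀ f s, Grown ρ i (GTerm.app f s) →
      (GTerm.app f s).subst θ ≠ θ x := by
    intro x hx f s hf he
    refine hθ.init_not_mem hx hf ?_
    rw [he]
    exact (hθ.isTermOver x hx).self_mem_kin
  induction t generalizing t' with
  | const c =>
    obtain ⟨x, hx, rfl⟩ := ht.exists_eq_substUc
    rw [GTerm.subst_uc] at h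
    cases t' with
    | const c' =>
      obtain ⟨x', hx', rfl⟩ := ht'.exists_eq_substUc
      rw [GTerm.subst_uc] at h
      rw [hθ.inj hx hx' h]
    | app f s => exact absurd h.symm (key x hx f s ht')
  | app f s ih =>
    cases t' with
    | const c' =>
      obtain ⟨x', hx', rfl⟩ := ht'.exists_eq_substUc
      rw [GTerm.subst_uc] at h
      exact absurd h (key x' hx' f s ht)
    | app f' s' =>
      rw [GTerm.subst_app, GTerm.subst_app] at h
      injection h with h1 h2
      subst h1
      have hf : f.var ∈ f.rule.exVars f.idx := GTerm.var_mem_exVars ht.self_mem_kin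
      congr 1
      funext x
      have hk : ∀ r : f.rule.frontier → GTerm S, Grown ρ i (.app f r) → Grown ρ i (r x) := by
        intro r hr
        cases hr with
        | init z hz => exact .uc (x : S.Var) (Subtype.property x).1
        | app _ _ _ hs _ => exact hs x
      exact ih x (hk s ht) (hk s' ht') (congrFun (eq_of_heq h2) x)

open Classical in
/-- The inverse of `subst θ` on the skeleton of `l`. The constants `c_f` are fixed, and all other
terms are mapped to `⋆`. -/
noncomputable def Trigger.pull (l : Trigger S) (θ : S.Var → GTerm S) (t : GTerm S) : GTerm S :=
  if h : ∃ v ∈ l.skeleton, v.subst θ = t then h.choose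
  else if t.IsMark then t else .const .star

theorem Trigger.pull_mem_or (l : Trigger S) (θ : S.Var → GTerm S) (t : GTerm S) :
    (l.pull θ t ∈ l.skeleton ∧ (l.pull θ t).subst θ = t) ∨
      (l.pull θ t).IsMark ∧ ¬ ∃ v ∈ l.skeleton, v.subst θ = t := by
  unfold Trigger.pull
  split_ifs with h h'
  · exact Or.inl h.choose_spec
  · exact Or.inr ⟨h', h⟩
  · exact Or.inr ⟨Or.inl rfl, h⟩

theorem Trigger.pull_of_not_exists {l : Trigger S} {θ : S.Var → GTerm S} {t : GTerm S}
    (h : ¬ ∃ v ∈ l.skeleton, v.subst θ = t) (ht : ¬ t.IsMark) :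
    l.pull θ t = .const .star := by
  rw [Trigger.pull, dif_neg h, if_neg ht]

theorem Trigger.pull_of_isMark {l : Trigger S} {θ : S.Var → GTerm S} {t : GTerm S}
    (h : ¬ ∃ v ∈ l.skeleton, v.subst θ = t) (ht : t.IsMark) : l.pull θ t = t := by
  rw [Trigger.pull, dif_neg h, if_pos ht]

theorem OverApprox.args_mem_or {R : Set (Rule S)} {hc : HeadChoice S} {l : Trigger S}
    (hl : l.IsTriggerOf R) {A : Fact S} (h : OverApprox R hc l A) (k : Fin (S.ar A.pred)) :
    A.args k ∈ l.skeleton ∨ (A.args k).IsMark := by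
  cases h with
  | crit A hp hA =>
    obtain ⟨c, h, h'⟩ := hA k
    rcases h' with h' | rfl
    · exact Or.inl h'
    · exact Or.inr (Or.inl h)
  | birth A hA =>
    obtain ⟨x, hx, hA⟩ := Set.mem_iUnion₂.1 hA
    exact Or.inl (hl.mem_skeleton_iff.2 ⟨x, hx, (hl.2 x hx.1).args_mem_kin hA k⟩)
  | step t ht hl hne A hA => exact l.hUc_mem_or _

/-- A trigger `l` over grown terms and a replayable substitution `θ`. -/
structure ReplaySetup (R : Set (Rule S)) (ρ : Rule S) (i : Fin ρ.branching) (θ : S.Var → GTerm S)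
    (l : Trigger S) : Prop where
  replayable : Replayable R ρ i θ
  isTriggerOf : l.IsTriggerOf R
  grown : ∀ x ∈ l.rule.bodyVars, Grown ρ i (l.subst x)

namespace ReplaySetup

variable {R : Set (Rule S)} {ρ : Rule S} {i : Fin ρ.branching} {θ : S.Var → GTerm S}
  {l : Trigger S}

theorem grown_of_mem (h : ReplaySetup R ρ i θ l) {u : GTerm S} (hu : u ∈ l.skeleton) :
    Grown ρ i u := by
  obtain ⟨x, hx, hu⟩ := h.isTriggerOf.mem_skeleton_iff.1 hu
  exact (h.grown x hx.1).of_mem_kin hu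

theorem unmarked (h : ReplaySetup R ρ i θ l) : l.Unmarked :=
  fun _ hu => (h.grown_of_mem hu).not_isMark

theorem comp_isTriggerOf (h : ReplaySetup R ρ i θ l) :
    (l.comp (GTerm.subst θ)).IsTriggerOf R :=
  Trigger.comp_isTriggerOf h.isTriggerOf fun x hx => (h.isTriggerOf.2 x hx).subst fun z hz =>
    h.replayable.isTermOver z ((h.grown x hx).of_mem_kin hz).mem_bodyVars

theorem pull_subst (h : ReplaySetup R ρ i θ l) {v : GTerm S} (hv : v ∈ l.skeleton) :
    l.pull θ (v.subst θ) = v := by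
  rcases l.pull_mem_or θ (v.subst θ) with ⟨h1, h2⟩ | ⟨-, h1⟩
  · exact h.replayable.subst_injective (h.grown_of_mem h1) (h.grown_of_mem hv) h2
  · exact absurd ⟨v, hv, rfl⟩ h1

theorem kin_subset (h : ReplaySetup R ρ i θ l) {z : S.Var}
    (hz : GTerm.const (Const.uc z) ∈ l.skeleton) :
    (θ z).kin ⊆ (l.comp (GTerm.subst θ)).skeleton := by
  obtain ⟨x, hx, hz⟩ := h.isTriggerOf.mem_skeleton_iff.1 hz
  intro w hw
  exact h.comp_isTriggerOf.mem_skeleton_iff.2 ⟨x, hx, GTerm.kin_subset_kin_subst hz hw⟩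

theorem subst_mem (h : ReplaySetup R ρ i θ l) {v : GTerm S} (hv : v ∈ l.skeleton) :
    v.subst θ ∈ (l.comp (GTerm.subst θ)).skeleton := by
  cases v with
  | const c =>
    obtain ⟨z, hz, rfl⟩ := (h.grown_of_mem hv).exists_eq_substUc
    rw [GTerm.subst_uc]
    exact h.kin_subset hv (h.replayable.isTermOver z hz).self_mem_kin
  | app f s =>
    obtain ⟨x, hx, hv⟩ := h.isTriggerOf.mem_skeleton_iff.1 hv
    exact h.comp_isTriggerOf.mem_skeleton_iff.2 ⟨x, hx, GTerm.subst_app_mem_kin hv⟩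

theorem mem_comp_skeleton (h : ReplaySetup R ρ i θ l) {t : GTerm S}
    (ht : t ∈ (l.comp (GTerm.subst θ)).skeleton) :
    (∃ v ∈ l.skeleton, t = v.subst θ) ∨
      ∃ z, GTerm.const (Const.uc z) ∈ l.skeleton ∧ t ∈ (θ z).kin := by
  obtain ⟨x, hx, ht⟩ := h.comp_isTriggerOf.mem_skeleton_iff.1 ht
  have hm : ∀ u ∈ (l.subst x).kin, u ∈ l.skeleton :=
    fun u hu => h.isTriggerOf.mem_skeleton_iff.2 ⟨x, hx, hu⟩
  rcases GTerm.mem_kin_subst ht with ⟨v, hv, h⟩ | ⟨z, hz, h⟩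
  · exact Or.inl ⟨v, hm v hv, h⟩
  · exact Or.inr ⟨z, hm _ hz, h⟩

theorem comp_unmarked (h : ReplaySetup R ρ i θ l) :
    (l.comp (GTerm.subst θ)).Unmarked := by
  intro t ht
  rcases h.mem_comp_skeleton ht with ⟨v, hv, rfl⟩ | ⟨z, hz, ht⟩
  · cases v with
    | const c =>
      obtain ⟨z, hz, rfl⟩ := (h.grown_of_mem hv).exists_eq_substUc
      rw [GTerm.subst_uc]
      exact h.replayable.unmarked z hz _ (h.replayable.isTermOver z hz).self_mem_kin
    | app f s =>
      rw [GTerm.subst_app]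
      exact GTerm.not_isMark_app _ _
  · exact h.replayable.unmarked z (h.grown_of_mem hz).mem_bodyVars t ht

theorem pull_of_isMark (h : ReplaySetup R ρ i θ l) {t : GTerm S} (ht : t.IsMark) :
    l.pull θ t = t := by
  refine Trigger.pull_of_isMark ?_ ht
  rintro ⟨v, hv, rfl⟩
  exact h.comp_unmarked _ (h.subst_mem hv) ht

/-- Kin of the values of `θ` are pulled back to constants. -/
theorem pull_const (h : ReplaySetup R ρ i θ l) {z : S.Var}
    (hz : GTerm.const (Const.uc z) ∈ l.skeleton) {t : GTerm S} (ht : t ∈ (θ z).kin) :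
    ∃ c, l.pull θ t = .const c ∧ (l.pull θ t ∈ l.skeleton ∨ c = Const.star) := by
  have hzb := (h.grown_of_mem hz).mem_bodyVars
  by_cases hv : ∃ v ∈ l.skeleton, v.subst θ = t
  · obtain ⟨v, hv, rfl⟩ := hv
    rw [h.pull_subst hv]
    cases v with
    | const c => exact ⟨c, rfl, Or.inl hv⟩
    | app f s => exact absurd ht (h.replayable.init_not_mem hzb (h.grown_of_mem hv))
  · exact ⟨_, Trigger.pull_of_not_exists hv (h.replayable.unmarked z hzb t ht), Or.inr rfl⟩

theorem overApprox_of_kin (h : ReplaySetup R ρ i θ l) (hc : HeadChoice S) {z : S.Var}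
    (hz : GTerm.const (Const.uc z) ∈ l.skeleton) {A : Fact S} (hp : PredOccurs R A.pred)
    (hA : ∀ k, A.args k ∈ (θ z).kin) : OverApprox R hc l (A.map (l.pull θ)) :=
  .crit _ hp fun k => h.pull_const hz (hA k)

/-- A new Skolem term in the replayed skeleton that is not kin of a value of `θ` is the image of a
skeleton term of `l`, which pulling back restores. A term outside the skeleton becomes `c_f` on both
sides. -/
theorem pull_hUc_skTerm (h : ReplaySetup R ρ i θ l) {r : Rule S} {j : Fin r.branching}
    {s : r.frontier → GTerm S}
    (hs : ∀ x, s x ∈ (l.comp (GTerm.subst θ)).skeleton ∨ (s x).IsMark)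
    (hno : ∀ w, GTerm.const (Const.uc w) ∈ l.skeleton → ∀ z, GTerm.app ⟨r, j, z⟩ s ∉ (θ w).kin)
    (z : S.Var) :
    l.pull θ ((l.comp (GTerm.subst θ)).hUc (r.skTerm j s z)) =
      l.hUc (r.skTerm j (fun x => l.pull θ (s x)) z) := by
  by_cases hz : z ∈ r.frontier
  · rw [Rule.skTerm_of_mem hz, Rule.skTerm_of_mem hz]
    have h1 : (l.comp (GTerm.subst θ)).hUc (s ⟨z, hz⟩) = s ⟨z, hz⟩ := by
      rcases hs ⟨z, hz⟩ with h1 | h1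
      · exact Trigger.hUc_of_mem h1
      · exact Trigger.hUc_of_isMark h1
    rw [h1]
    rcases l.pull_mem_or θ (s ⟨z, hz⟩) with ⟨h2, -⟩ | ⟨h2, -⟩
    · exact (Trigger.hUc_of_mem h2).symm
    · exact (Trigger.hUc_of_isMark h2).symm
  · rw [Rule.skTerm_of_not_mem hz, Rule.skTerm_of_not_mem hz]
    by_cases hm : GTerm.app ⟨r, j, z⟩ s ∈ (l.comp (GTerm.subst θ)).skeleton
    · rw [Trigger.hUc_of_mem hm]
      rcases h.mem_comp_skeleton hm with ⟨v, hv, he⟩ | ⟨w, hw, he⟩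
      · cases v with
        | const c =>
          obtain ⟨w, hw, rfl⟩ := (h.grown_of_mem hv).exists_eq_substUc
          rw [GTerm.subst_uc] at he
          refine absurd ?_ (hno w hv z)
          rw [he]
          exact (h.replayable.isTermOver w hw).self_mem_kin
        | app f s' =>
          rw [he, h.pull_subst hv]
          rw [GTerm.subst_app] at he
          injection he with h1 h2
          subst h1
          have h3 : (fun x => l.pull θ (s x)) = s' := by
            funext x
            rw [congrFun (eq_of_heq h2) x]
            exact h.pull_subst (h.isTriggerOf.arg_mem_skeleton hv x)
          rw [h3, Trigger.hUc_of_mem hv]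
      · exact absurd he (hno w hw z)
    · rw [Trigger.hUc_app hm, h.pull_of_isMark (Or.inr ⟨_, rfl⟩), Trigger.hUc_app]
      intro h1
      apply hm
      have h2 := h.subst_mem h1
      rw [GTerm.subst_app] at h2
      convert h2 using 2
      funext x
      have h3 := h.isTriggerOf.arg_mem_skeleton h1 x
      rcases l.pull_mem_or θ (s x) with ⟨-, h4⟩ | ⟨h4, -⟩
      · exact h4.symm
      · exact absurd h4 (h.unmarked _ h3)

/-- The over-approximation for the replayed trigger is pulled back into the one for `l`. -/
theorem overApprox_pull (h : ReplaySetup R ρ i θ l) {hc : HeadChoice S} {A : Fact S}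
    (hA : OverApprox R hc (l.comp (GTerm.subst θ)) A) : OverApprox R hc l (A.map (l.pull θ)) := by
  induction hA with
  | crit A hp hA =>
    refine .crit _ hp fun k => ?_
    change ∃ c, l.pull θ (A.args k) = _ ∧ (l.pull θ (A.args k) ∈ _ ∨ _)
    obtain ⟨c, hc, hA⟩ := hA k
    rcases hA with hA | rfl
    · rcases h.mem_comp_skeleton hA with ⟨v, hv, he⟩ | ⟨z, hz, he⟩
      · cases v with
        | const c =>
          rw [he, h.pull_subst hv]
          exact ⟨c, rfl, Or.inl hv⟩
        | app f s =>
          rw [he, GTerm.subst_app] at hc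
          cases hc
      · exact h.pull_const hz he
    · exact ⟨_, by rw [hc]; exact h.pull_of_isMark (Or.inl rfl), Or.inr rfl⟩
  | birth A hA =>
    obtain ⟨x, hx, hA⟩ := Set.mem_iUnion₂.1 hA
    have hA : A ∈ ((l.subst x).subst θ).birthFacts := hA
    have hxR := h.isTriggerOf.2 x hx.1
    rcases GTerm.mem_birthFacts_subst hA with ⟨B, hB, rfl⟩ | ⟨z, hz, hB⟩
    · refine .birth _ (Set.mem_iUnion₂.2 ⟨x, hx, ?_⟩)
      convert hB using 1
      refine congrArg (Atom.mk B.pred) (funext fun k => h.pull_subst ?_)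
      exact h.isTriggerOf.mem_skeleton_iff.2 ⟨x, hx, hxR.args_mem_kin hB k⟩
    · have hzs := h.isTriggerOf.mem_skeleton_iff.2 ⟨x, hx, hz⟩
      have hzR := h.replayable.isTermOver z (h.grown_of_mem hzs).mem_bodyVars
      exact h.overApprox_of_kin hc hzs (hzR.predOccurs hB) (hzR.args_mem_kin hB)
  | step t ht hl hne A hA ih =>
    have hs : ∀ x ∈ t.rule.bodyVars,
        t.subst x ∈ (l.comp (GTerm.subst θ)).skeleton ∨ (t.subst x).IsMark := by
      rintro x ⟨a, ha, k, rfl⟩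
      exact (hl a ha).args_mem_or h.comp_isTriggerOf k
    obtain ⟨a, ha, rfl⟩ := hA
    -- If no Skolem term over the values of `t` is kin of a value of `θ`, the pulled-back trigger is
    -- a step for `l`. Otherwise, all terms of the output are kin of one `θ w`, so they are pulled
    -- back to constants and the fact is one of the initial ones.
    by_cases hno : ∀ w, GTerm.const (Const.uc w) ∈ l.skeleton →
        ∀ z, GTerm.app ⟨t.rule, hc t.rule, z⟩ (fun x => t.subst x) ∉ (θ w).kin
    · have ht' : (t.comp (l.pull θ)).IsTriggerOf R := by
        refine Trigger.comp_isTriggerOf ht fun x _ => ?_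
        rcases l.pull_mem_or θ (t.subst x) with ⟨h1, -⟩ | ⟨h1, -⟩
        · exact h.isTriggerOf.isTermOver h1
        · exact h1.isTermOver R
      have key := OverApprox.step (R := R) (hc := hc) (t := l) (t.comp (l.pull θ)) ht' ih ?_
        (a.map (t.rule.skTerm (hc t.rule) fun x => l.pull θ (t.subst x))) ⟨a, ha, rfl⟩
      · convert key using 1
        rw [Atom.map_map, Atom.map_map, Atom.map_map]
        exact Atom.map_congr fun k => h.pull_hUc_skTerm (fun x => hs x x.2.1) hno _
      · intro he
        refine hne (h.isTriggerOf.outHc_eq (fun x _ => ?_) (fun x _ hx => ?_) he)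
        · exact (l.pull_mem_or θ (t.subst x)).imp And.left And.left
        · rcases l.pull_mem_or θ (t.subst x) with ⟨-, h1⟩ | ⟨h1, -⟩
          · exact h1
          · exact absurd h1 (h.unmarked _ hx)
    · push Not at hno
      obtain ⟨w, hw, z, hz⟩ := hno
      have hwR := h.replayable.isTermOver w (h.grown_of_mem hw).mem_bodyVars
      have hargs : ∀ k, t.rule.skTerm (hc t.rule) (fun x => t.subst x) (a.args k) ∈ (θ w).kin := by
        intro k
        by_cases hk : a.args k ∈ t.rule.frontier
        · rw [Rule.skTerm_of_mem hk]
          exact GTerm.kin_arg_subset hz ⟨_, hk⟩ (ht.2 _ hk.1).self_mem_kin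
        · rw [Rule.skTerm_of_not_mem hk]
          exact GTerm.sibling_mem_kin hz (Rule.mem_exVars (mem_varsOf ha k) hk)
      refine h.overApprox_of_kin hc hw ⟨_, ht.1, a, Or.inr ⟨_, ha⟩, rfl⟩ fun k => ?_
      change (l.comp (GTerm.subst θ)).hUc (t.rule.skTerm _ _ (a.args k)) ∈ _
      rw [Trigger.hUc_of_mem (h.kin_subset hw (hargs k))]
      exact hargs k

theorem ucUnblockable (h : ReplaySetup R ρ i θ l) {hc : HeadChoice S}
    (hub : l.UcUnblockable R hc) : (l.comp (GTerm.subst θ)).UcUnblockable R hc := by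
  refine hub.imp id fun hn ho => hn ?_
  exact Trigger.obsolete_overApprox
    (fun x hx => h.pull_subst (h.isTriggerOf.subst_mem_skeleton hx))
    (fun A hA => h.overApprox_pull hA) ho

end ReplaySetup

end Replay

/-! ### From a cyclic term to infinitely many terms -/

section Cyclic

variable {S : Signature.{u, v}}

/-- Unblockable triggers that are not datalog have a functional frontier term. -/
theorem Trigger.UcUnblockable.exists_app {R : Set (Rule S)} {hc : HeadChoice S} {l : Trigger S}
    (hl : l.IsTriggerOf R) (hub : l.UcUnblockable R hc) (hg : l.rule.IsGenerating) :
    ∃ x ∈ l.rule.frontier, ∃ f s, l.subst x = .app f s := by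
  classical
  rcases hub with hd | hn
  · exact absurd hg hd.2
  · by_contra hno
    push Not at hno
    -- With constants only on the frontier, sending all existential variables to `⋆` lands in the
    -- initial facts of the over-approximation.
    refine hn ⟨fun x => if x ∈ l.rule.bodyVars then l.subst x else .const .star,
      fun x hx => if_pos hx, hc l.rule, fun a ha => ?_⟩
    refine .crit _ ⟨_, hl.1, a, Or.inr ⟨_, ha⟩, rfl⟩ fun k => ?_
    change ∃ c, (if a.args k ∈ l.rule.bodyVars then _ else _) = _ ∧
      ((if a.args k ∈ l.rule.bodyVars then _ else _) ∈ _ ∨ _)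
    split_ifs with hx
    · have hf : a.args k ∈ l.rule.frontier := ⟨hx, _, mem_varsOf ha k⟩
      cases hs : l.subst (a.args k) with
      | const c => exact ⟨c, rfl, Or.inl (hs ▸ hl.subst_mem_skeleton hf)⟩
      | app f s => exact absurd hs (hno _ hf f s)
    · exact ⟨_, rfl, Or.inr rfl⟩

/-- Terms created after the start have a functional argument, because an unblockable generating
trigger has a functional frontier term. -/
theorem RpcFacts.grown {R : Set (Rule S)} {hc : HeadChoice S} {ρ : Rule S} {A : Fact S}
    (h : RpcFacts R hc ρ A) (k : Fin (S.ar A.pred)) : Grown ρ (hc ρ) (A.args k) := by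
  induction h with
  | database A hA =>
    obtain ⟨a, ha, rfl⟩ := hA
    exact .uc _ (mem_varsOf ha k)
  | init A hA =>
    obtain ⟨a, ha, rfl⟩ := hA
    change Grown _ _ (ρ.skTerm _ _ (a.args k))
    by_cases hz : a.args k ∈ ρ.frontier
    · rw [Rule.skTerm_of_mem hz]
      exact .uc _ hz.1
    · rw [Rule.skTerm_of_not_mem hz]
      exact .init _ (Rule.mem_exVars (mem_varsOf ha k) hz)
  | step t ht hcyc hl hub hinj A hA ih =>
    have hb : ∀ x ∈ t.rule.bodyVars, Grown ρ (hc ρ) (t.subst x) := by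
      rintro x ⟨a, ha, j, rfl⟩
      exact ih a ha j
    obtain ⟨a, ha, rfl⟩ := hA
    change Grown _ _ (t.rule.skTerm _ _ (a.args k))
    by_cases hz : a.args k ∈ t.rule.frontier
    · rw [Rule.skTerm_of_mem hz]
      exact hb _ hz.1
    · rw [Rule.skTerm_of_not_mem hz]
      have he := Rule.mem_exVars (mem_varsOf ha k) hz
      obtain ⟨x, hx, f, s, hs⟩ := hub.exists_app ht ⟨_, _, he⟩
      exact .app _ _ he (fun x => hb x x.2.1) ⟨⟨x, hx⟩, f, s, hs⟩

theorem RpcFacts.isTermOver {R : Set (Rule S)} {hc : HeadChoice S} {ρ : Rule S} (hρ : ρ ∈ R)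
    {A : Fact S} (h : RpcFacts R hc ρ A) (k : Fin (S.ar A.pred)) :
    (A.args k).IsTermOver R := by
  have key : ∀ t : Trigger S, t.IsTriggerOf R → ∀ a ∈ t.rule.head (hc t.rule), ∀ z ∈ varsOf
      (t.rule.head (hc t.rule)),
      (t.rule.skTerm (hc t.rule) (fun x => t.subst x) z).IsTermOver R := by
    intro t ht a ha z hv
    by_cases hz : z ∈ t.rule.frontier
    · rw [Rule.skTerm_of_mem hz]
      exact ht.2 _ hz.1
    · rw [Rule.skTerm_of_not_mem hz, GTerm.isTermOver_app]
      exact ⟨⟨ht.1, Rule.mem_exVars hv hz⟩, fun x => ht.2 _ x.2.1⟩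
  cases h with
  | database A hA =>
    obtain ⟨a, ha, rfl⟩ := hA
    exact GTerm.isTermOver_const R _
  | init A hA =>
    obtain ⟨a, ha, rfl⟩ := hA
    exact key ⟨ρ, substUc S⟩ ⟨hρ, fun x _ => GTerm.isTermOver_const R _⟩ a ha _ (mem_varsOf ha k)
  | step t ht hcyc hl hub hinj A hA =>
    obtain ⟨a, ha, rfl⟩ := hA
    exact key t ht a ha _ (mem_varsOf ha k)

/-- The RPC facts are contained, up to `subst θ`, in every fact set that is closed under unblockable
triggers and contains the image under `θ` of the body of `ρ` and of its output. -/
theorem RpcFacts.map_subst_mem {R : Set (Rule S)} {hc : HeadChoice S} {ρ : Rule S}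
    {G : Set (Fact S)}
    (hG : ∀ l : Trigger S, l.IsTriggerOf R → l.Unmarked → l.Loaded G → l.UcUnblockable R hc →
      l.outHc hc ⊆ G)
    {θ : S.Var → GTerm S} (hθ : Replayable R ρ (hc ρ) θ) (hb : ∀ a ∈ ρ.body, a.map θ ∈ G)
    (hi : Trigger.outHc ⟨ρ, θ⟩ hc ⊆ G) {A : Fact S} (h : RpcFacts R hc ρ A) :
    A.map (GTerm.subst θ) ∈ G := by
  induction h with
  | database A hA =>
    obtain ⟨a, ha, rfl⟩ := hA
    convert hb a ha using 1
    exact (Atom.map_map _ _ a).trans (Atom.map_congr fun k => GTerm.subst_substUc' _ _)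
  | init A hA =>
    apply hi
    have := Trigger.outHc_comp_subst θ ⟨ρ, substUc S⟩ hc
    have e : Trigger.comp ⟨ρ, substUc S⟩ (GTerm.subst θ) = ⟨ρ, θ⟩ :=
      congrArg (Trigger.mk ρ) (funext fun x => GTerm.subst_substUc' θ x)
    rw [← e, this]
    exact ⟨A, hA, rfl⟩
  | step t ht hcyc hl hub hinj A hA ih =>
    have hs : ReplaySetup R ρ (hc ρ) θ t := by
      refine ⟨hθ, ht, ?_⟩
      rintro x ⟨a, ha, j, rfl⟩
      exact (hl a ha).grown j
    refine hG _ hs.comp_isTriggerOf hs.comp_unmarked (fun a ha => ih a ha)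
      (hs.ucUnblockable hub) ?_
    rw [Trigger.outHc_comp_subst]
    exact ⟨A, hA, rfl⟩

/-- Substitutions of triggers for `ρ` that reproduce the start of the derivation of
`RpcFacts R hc ρ` with new terms. -/
structure Cycle (R : Set (Rule S)) (hc : HeadChoice S) (ρ : Rule S) (τ : S.Var → GTerm S) :
    Prop where
  loaded : ∀ a ∈ ρ.body, RpcFacts R hc ρ (a.map τ)
  out : ∀ A ∈ Trigger.outHc ⟨ρ, τ⟩ hc, RpcFacts R hc ρ A
  inj : Set.InjOn τ ρ.bodyVars
  exists_app : ∃ x ∈ ρ.frontier, ∃ f s, τ x = .app f s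
  fresh : ∀ x ∈ ρ.bodyVars, ∀ z, GTerm.app ⟨ρ, hc ρ, z⟩ (fun x => τ x) ∉ (τ x).kin

/-- Trace the term back to the trigger for `ρ` that created it or a sibling. Terms of the start have
only constant arguments, so this is a later trigger. If it is not fresh, a sibling with the same
arguments occurs in its body, and the search continues at an earlier fact. -/
theorem RpcFacts.exists_cycle {R : Set (Rule S)} {hc : HeadChoice S} {ρ : Rule S} {A : Fact S}
    (h : RpcFacts R hc ρ A) {k : Fin (S.ar A.pred)} {f : FnSym S} {s : f.rule.frontier → GTerm S}
    (hf : f.rule = ρ) (hk : GTerm.app f s ∈ (A.args k).kin)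
    (hs : ∃ x g r, s x = .app g r) : ∃ τ, Cycle R hc ρ τ := by
  induction h generalizing f with
  | database A hA =>
    obtain ⟨a, ha, rfl⟩ := hA
    cases GTerm.mem_kin_const.1 hk
  | init A hA =>
    exfalso
    obtain ⟨a, ha, rfl⟩ := hA
    change _ ∈ (ρ.skTerm _ _ (a.args k)).kin at hk
    obtain ⟨x, g, r, hx⟩ := hs
    by_cases hz : a.args k ∈ ρ.frontier
    · rw [Rule.skTerm_of_mem hz] at hk
      cases GTerm.mem_kin_const.1 hk
    · rw [Rule.skTerm_of_not_mem hz] at hk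
      rcases GTerm.mem_kin_app.1 hk with ⟨y, hy, he⟩ | ⟨y, hy⟩
      · cases he
        cases hx
      · cases GTerm.mem_kin_const.1 hy
  | step t ht hcyc hl hub hinj A hA ih =>
    have hbody : ∀ x ∈ t.rule.bodyVars, ∀ (g : FnSym S) (r : g.rule.frontier → GTerm S),
        g.rule = ρ → GTerm.app g r ∈ (t.subst x).kin → (∃ x g' r', r x = .app g' r') →
        ∃ τ, Cycle R hc ρ τ := by
      rintro x ⟨a, ha, j, rfl⟩ g r hg hm hr
      exact ih a ha hg hm hr
    have hA' := hA
    obtain ⟨a, ha, rfl⟩ := hA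
    change _ ∈ (t.rule.skTerm _ _ (a.args k)).kin at hk
    by_cases hz : a.args k ∈ t.rule.frontier
    · rw [Rule.skTerm_of_mem hz] at hk
      exact hbody _ hz.1 f s hf hk hs
    · rw [Rule.skTerm_of_not_mem hz] at hk
      rcases GTerm.mem_kin_app.1 hk with ⟨y, hy, he⟩ | ⟨y, hy⟩
      · cases he
        obtain ⟨r, τ⟩ := t
        change r = ρ at hf
        subst hf
        by_cases hfresh : ∀ x ∈ r.bodyVars, ∀ z,
            GTerm.app ⟨r, hc r, z⟩ (fun x => τ x) ∉ (τ x).kin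
        · obtain ⟨x, g, q, hx⟩ := hs
          -- Injectivity of `τ` is the side condition that `RpcFacts` imposes on triggers for `ρ`.
          exact ⟨τ, hl, fun B hB => .step _ ht hcyc hl hub hinj B hB, hinj rfl,
            ⟨x, x.2, g, q, hx⟩, hfresh⟩
        · push Not at hfresh
          obtain ⟨x, hx, z, hz⟩ := hfresh
          exact hbody x hx _ _ rfl hz hs
      · exact hbody y y.2.1 f s hf hy hs

theorem IsRPC.exists_cycle {R : Set (Rule S)} (h : IsRPC R) :
    ∃ hc : HeadChoice S, ∃ ρ ∈ R, ∃ τ, Cycle R hc ρ τ := by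
  obtain ⟨hc, ρ, hρ, -, t, ⟨A, hA, k, hk⟩, f, s, rfl, hf, x, hx⟩ := h
  refine ⟨hc, ρ, hρ, RpcFacts.exists_cycle hA hf.1
    ((RpcFacts.isTermOver hρ hA k).subterms_subset_kin hk) ⟨x, ?_⟩⟩
  cases hs : s x with
  | const c =>
    rw [hs] at hx
    simp [GTerm.fnSyms] at hx
  | app g r => exact ⟨g, r, rfl⟩

/-- The iterates of `τ`. -/
def iterSubst (τ : S.Var → GTerm S) : ℕ → S.Var → GTerm S
  | 0 => substUc S
  | n + 1 => fun x => (τ x).subst (iterSubst τ n)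

namespace Cycle

variable {R : Set (Rule S)} {hc : HeadChoice S} {ρ : Rule S} {τ : S.Var → GTerm S}

theorem grown (h : Cycle R hc ρ τ) {x : S.Var} (hx : x ∈ ρ.bodyVars) :
    Grown ρ (hc ρ) (τ x) := by
  obtain ⟨a, ha, k, rfl⟩ := hx
  exact (h.loaded a ha).grown k

theorem isTermOver (h : Cycle R hc ρ τ) (hρ : ρ ∈ R) {x : S.Var} (hx : x ∈ ρ.bodyVars) :
    (τ x).IsTermOver R := by
  obtain ⟨a, ha, k, rfl⟩ := hx
  exact (h.loaded a ha).isTermOver hρ k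

/-- Each property of the next iterate follows from the one for `τ` and replayability of the current
iterate, which is injective on the grown terms produced by `τ`. -/
theorem replayable (h : Cycle R hc ρ τ) (hρ : ρ ∈ R) (n : ℕ) :
    Replayable R ρ (hc ρ) (iterSubst τ n) := by
  induction n with
  | zero =>
    refine ⟨fun x _ y _ he => ?_, fun x _ z hm => ?_, fun x _ => GTerm.isTermOver_const R _,
      fun x hx u hu => ?_⟩
    · cases he
      rfl
    · cases GTerm.mem_kin_const.1 hm
    · exact ((Grown.uc (i := hc ρ) x hx).of_mem_kin hu).not_isMark
  | succ n ih =>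
    refine ⟨fun x hx y hy he => ?_, fun x hx z hm => ?_, fun x hx => ?_, fun x hx u hu => ?_⟩
    · exact h.inj hx hy (ih.subst_injective (h.grown hx) (h.grown hy) he)
    · have hg : Grown ρ (hc ρ) (.app ⟨ρ, hc ρ, z⟩ (fun x => τ x)) := by
        obtain ⟨y, hy, f, s, hs⟩ := h.exists_app
        exact .app _ _ (GTerm.var_mem_exVars hm) (fun x => h.grown x.2.1) ⟨⟨y, hy⟩, f, s, hs⟩
      have he : (GTerm.app ⟨ρ, hc ρ, z⟩ (fun x : ρ.frontier => τ x)).subst (iterSubst τ n) =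
          .app ⟨ρ, hc ρ, z⟩ (fun x : ρ.frontier => iterSubst τ (n + 1) x) :=
        GTerm.subst_app _ _ _
      rw [← he] at hm
      -- A term born too early is the image of a kin of `τ x`, against freshness of `τ` by
      -- injectivity, or it is kin of a value of the previous iterate, against `init_not_mem`.
      rcases GTerm.mem_kin_subst hm with ⟨v, hv, hve⟩ | ⟨y, hy, hm⟩
      · rw [← ih.subst_injective hg ((h.grown hx).of_mem_kin hv) hve] at hv
        exact h.fresh x hx z hv
      · exact ih.init_not_mem ((h.grown hx).of_mem_kin hy).mem_bodyVars hg hm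
    · exact (h.isTermOver hρ hx).subst fun z hz => ih.isTermOver z ((h.grown hx).of_mem_kin hz).mem_bodyVars
    · rcases GTerm.mem_kin_subst hu with ⟨v, hv, rfl⟩ | ⟨y, hy, hu⟩
      · have hv' := (h.grown hx).of_mem_kin hv
        cases v with
        | const c =>
          obtain ⟨z, hz, rfl⟩ := hv'.exists_eq_substUc
          rw [GTerm.subst_uc]
          exact ih.unmarked z hz _ (ih.isTermOver z hz).self_mem_kin
        | app f s =>
          rw [GTerm.subst_app]
          exact GTerm.not_isMark_app _ _
      · exact ih.unmarked y ((h.grown hx).of_mem_kin hy).mem_bodyVars u hu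

/-- The body and output of `⟨ρ, τ⟩` are themselves RPC facts, so replaying them along one iterate
supplies the start needed for the next. -/
theorem iterSubst_mem (h : Cycle R hc ρ τ) (hρ : ρ ∈ R) {G : Set (Fact S)}
    (hG : ∀ l : Trigger S, l.IsTriggerOf R → l.Unmarked → l.Loaded G → l.UcUnblockable R hc →
      l.outHc hc ⊆ G)
    (hb : ∀ a ∈ ρ.body, a.map (substUc S) ∈ G) (hi : Trigger.outHc ⟨ρ, substUc S⟩ hc ⊆ G)
    (n : ℕ) : (∀ a ∈ ρ.body, a.map (iterSubst τ n) ∈ G) ∧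
      Trigger.outHc ⟨ρ, iterSubst τ n⟩ hc ⊆ G := by
  induction n with
  | zero => exact ⟨hb, hi⟩
  | succ n ih =>
    have key : ∀ A, RpcFacts R hc ρ A → A.map (GTerm.subst (iterSubst τ n)) ∈ G :=
      fun A hA => hA.map_subst_mem hG (h.replayable hρ n) ih.1 ih.2
    refine ⟨fun a ha => key _ (h.loaded a ha), ?_⟩
    have e := Trigger.outHc_comp_subst (iterSubst τ n) ⟨ρ, τ⟩ hc
    change Trigger.outHc ⟨ρ, iterSubst τ (n + 1)⟩ hc = _ at e
    rw [e]
    rintro _ ⟨A, hA, rfl⟩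
    exact key A (h.out A hA)

theorem exists_injective (h : Cycle R hc ρ τ) (hρ : ρ ∈ R) :
    ∃ x ∈ ρ.bodyVars, Function.Injective fun n => iterSubst τ n x := by
  obtain ⟨x, hx, f, s, hs⟩ := h.exists_app
  refine ⟨x, hx.1, ?_⟩
  -- For a frontier variable with functional `τ x`, the next value has among its kin a Skolem term
  -- of `ρ` born from the current iterate. The kin of that term include those of the current value,
  -- and freshness makes the inclusion strict.
  have hmono : StrictMono fun n => (iterSubst τ n x).kin := by
    refine strictMono_nat_of_lt_succ fun n => ?_
    obtain ⟨z, hz⟩ := (h.grown hx.1).exists_init ⟨f, s, hs⟩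
    have hm : GTerm.app ⟨ρ, hc ρ, z⟩ (fun x : ρ.frontier => iterSubst τ n x) ∈
        (iterSubst τ (n + 1) x).kin := by
      have := GTerm.subst_app_mem_kin (θ := iterSubst τ n) hz
      rw [GTerm.subst_app] at this
      simp only [GTerm.subst_substUc'] at this
      exact this
    refine ⟨GTerm.kin_arg_subset hm ⟨x, hx⟩, fun hle => ?_⟩
    exact (h.replayable hρ n).fresh x hx.1 z (hle hm)
  exact fun m n he => hmono.injective (congrArg GTerm.kin he)

end Cycle

/-- No finite fact set that contains the start of a cycle is closed under unblockable triggers. -/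
theorem Cycle.not_finite {R : Set (Rule S)} {hc : HeadChoice S} {ρ : Rule S}
    {τ : S.Var → GTerm S} (h : Cycle R hc ρ τ) (hρ : ρ ∈ R) {G : Set (Fact S)}
    (hG : ∀ l : Trigger S, l.IsTriggerOf R → l.Unmarked → l.Loaded G → l.UcUnblockable R hc →
      l.outHc hc ⊆ G)
    (hb : ∀ a ∈ ρ.body, a.map (substUc S) ∈ G) (hi : Trigger.outHc ⟨ρ, substUc S⟩ hc ⊆ G) :
    ¬ G.Finite := by
  intro hfin
  obtain ⟨x, ⟨a, ha, k, rfl⟩, hinj⟩ := h.exists_injective hρ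
  have hargs : (⋃ A ∈ G, Set.range A.args).Finite := hfin.biUnion fun A _ => Set.finite_range _
  refine Set.infinite_range_of_injective hinj (hargs.subset ?_)
  rintro _ ⟨n, rfl⟩
  exact Set.mem_iUnion₂.2 ⟨_, (h.iterSubst_mem hρ hG hb hi n).1 a ha, k, rfl⟩

end Cyclic

end RPC

theorem mainTheorem1 (S : RPC.Signature.{u, v}) (R : Set (RPC.Rule S)) (hR : R.Finite)
    (hRPC : RPC.IsRPC R) : RPC.NeverTerminates R := by
  obtain ⟨hc, ρ, hρ, τ, hτ⟩ := hRPC.exists_cycle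
  refine ⟨ρ.headDatabase (hc ρ), ρ.headDatabase_finite _, ρ.headDatabase_functionFree _,
    fun T => ?_⟩
  by_contra hT
  rw [not_infinite_iff_finite] at hT
  obtain ⟨F, hF, hsat⟩ := T.exists_hcDerivation hT hc
  refine hτ.not_finite hρ (G := RPC.unfrozen ρ (hc ρ) F)
    (fun l hl hu hb hub => hF.outHc_subset hρ hsat hl hu hb hub) (fun a ha => ?_) ?_
    ((hF.finite (ρ.headDatabase_finite _)).image _)
  · exact ⟨_, hF.subset ⟨a, Or.inl ha, rfl⟩, RPC.map_unfreeze_body ha⟩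
  · rintro _ ⟨a, ha, rfl⟩
    exact ⟨_, hF.subset ⟨a, Or.inr ha, rfl⟩, RPC.map_unfreeze_head ha⟩
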